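/- **Setting.** Let $n\ge 1$, $d$, $s$ be natural numbers, and for each $k\in\{1,\dots,n\}$ let $\mathcal A_k\subset\mathbb C^d$ be a finite set of pure single-qudit states (unit vectors) with $|\mathcal A_k|\le s$. Let $\mathcal P=\{|\pi_1\rangle\otimes\cdots\otimes|\pi_n\rangle : |\pi_k\rangle\in\mathcal A_k\}$, and for an $n$-qudit density matrix $\rho$ and a real number $\eta$ let $\mathcal P_\eta=\mathcal P_\eta(\rho)=\{|\pi\rangle\in\mathcal P:\langle\pi|\rho|\pi\rangle\ge\eta\}$. Let $1/e\le\gamma<1$; $\log$ is the natural logarithm. An *algorithm* measures copies of an unknown $\rho$ one at a time, choosing each measurement (a POVM with finitely many outcomes) on the basis of the earlier outcomes, and finally outputs a set of vectors; the number of copies that it uses is counted in the worst case. **Theorem.** There is an absolute constant $C>0$ such that in this setting the following holds. 1. Suppose that $|\langle\phi|\phi'\rangle|^2\le\gamma$ for all $k$ and all distinct $|\phi\rangle,|\phi'\rangle\in\mathcal A_k$. Then for all $\eta,\varepsilon,\delta\in(0,1)$ with $\varepsilon\le\eta/2$ there is an algorithm that uses at most $$C\,(10ns)^{\log\frac{25}{\eta}/\log\frac1\gamma}\cdot\frac1{\varepsilon^2}\cdot\max\Bigl(1,\log\frac1\delta\Bigr)$$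 copies and that for every $n$-qudit state $\rho$ outputs, with probability at least $1-\delta$, a set $\mathcal S$ with $\mathcal P_\eta\subseteq\mathcal S\subseteq\mathcal P_{\eta-\varepsilon}$. 2. Suppose that even $|\langle\phi|\phi'\rangle|\le\gamma$ for all $k$ and all distinct $|\phi\rangle,|\phi'\rangle\in\mathcal A_k$. Then for every $\eta\in(0,1)$ and every $n$-qudit state $\rho$ $$|\mathcal P_\eta|\le(10ns)^{\log\frac2\eta/\log\frac1\gamma},$$ and for all $\eta,\varepsilon,\delta\in(0,1)$ with $\varepsilon\le\eta/2$ there is an algorithm with the guarantee and the bound on the number of copies stated in part 1 each of whose measurements is a measurement of one copy in a product of single-qudit orthonormal bases (one layer of single-qudit gates, followed by a measurement in the computational basis). -/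

import Mathlib

open scoped ComplexOrder

/-- Product vector `|π₁⟩ ⊗ ⋯ ⊗ |πₙ⟩` of `n` qudits, in the computational basis, which is indexed
by the strings `x : Fin n → Fin d`. -/
noncomputable def productState {n d : ℕ} (p : Fin n → EuclideanSpace ℂ (Fin d)) :
    (Fin n → Fin d) → ℂ :=
  fun x => ∏ k, p k (x k)

/-- `ρ` is the density matrix of an `n`-qudit state. -/
def IsDensity {n d : ℕ} (ρ : Matrix (Fin n → Fin d) (Fin n → Fin d) ℂ) : Prop :=
  ρ.PosSemidef ∧ ρ.trace = 1

/-- The fidelity `⟨v|ρ|v⟩`. -/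
noncomputable def fidelity {n d : ℕ} (ρ : Matrix (Fin n → Fin d) (Fin n → Fin d) ℂ)
    (v : (Fin n → Fin d) → ℂ) : ℝ :=
  (star v ⬝ᵥ ρ.mulVec v).re

/-- The class `𝒫 = A₁ ⊗ ⋯ ⊗ Aₙ`. -/
def productClass {n d : ℕ} (A : Fin n → Finset (EuclideanSpace ℂ (Fin d))) :
    Set ((Fin n → Fin d) → ℂ) :=
  {v | ∃ p : Fin n → EuclideanSpace ℂ (Fin d), (∀ k, p k ∈ A k) ∧ v = productState p}

/-- `𝒫_η`, the members of `𝒫` that have fidelity at least `η` with `ρ`. -/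
def goodStates {n d : ℕ} (A : Fin n → Finset (EuclideanSpace ℂ (Fin d)))
    (ρ : Matrix (Fin n → Fin d) (Fin n → Fin d) ℂ) (η : ℝ) : Set ((Fin n → Fin d) → ℂ) :=
  {v | v ∈ productClass A ∧ η ≤ fidelity ρ v}

/-- A quantum measurement with `m` outcomes (a POVM) on one copy of an `n`-qudit state. -/
structure Measurement (n d m : ℕ) where
  effect : Fin m → Matrix (Fin n → Fin d) (Fin n → Fin d) ℂ
  posSemidef : ∀ i, (effect i).PosSemidef
  sum_eq_one : ∑ i, effect i = 1

/-- The measurement is done by one layer of single-qudit unitaries followed by a measurement in the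
computational basis, that is, in a product of single-qudit orthonormal bases. -/
def Measurement.IsLocal {n d m : ℕ} (M : Measurement n d m) : Prop :=
  ∃ (b : Fin n → OrthonormalBasis (Fin d) ℂ (EuclideanSpace ℂ (Fin d)))
    (e : Fin m ≃ (Fin n → Fin d)), ∀ i,
      M.effect i = Matrix.vecMulVec (productState fun k => b k (e i k))
        (star (productState fun k => b k (e i k)))

/-- A learning algorithm: it measures fresh copies of the unknown state one at a time, may choose
each measurement according to the outcomes obtained so far, and finally outputs a set of vectors. -/
inductive Protocol (n d : ℕ) : Type
  | output (S : Set ((Fin n → Fin d) → ℂ)) : Protocol n d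
  | measure {m : ℕ} (M : Measurement n d m) (next : Fin m → Protocol n d) : Protocol n d

/-- The number of copies that the algorithm uses in the worst case. -/
def Protocol.copies {n d : ℕ} : Protocol n d → ℕ
  | .output _ => 0
  | .measure _ next => 1 + Finset.univ.sup fun i => (next i).copies

/-- All measurements of the algorithm are local. -/
def Protocol.IsLocal {n d : ℕ} : Protocol n d → Prop
  | .output _ => True
  | .measure M next => M.IsLocal ∧ ∀ i, (next i).IsLocal

/-- The probability (Born's rule) that the output lies in `good` when the algorithm is run on
copies of `ρ`. -/
noncomputable def Protocol.prob {n d : ℕ} (ρ : Matrix (Fin n → Fin d) (Fin n → Fin d) ℂ)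
    (good : Set (Set ((Fin n → Fin d) → ℂ))) : Protocol n d → ℝ
  | .output S => good.indicator 1 S
  | .measure M next => ∑ i, (M.effect i * ρ).trace.re * (next i).prob ρ good

/-- On every unknown state `ρ`, with probability at least `1 - δ` the output `S` satisfies
`𝒫_η ⊆ S ⊆ 𝒫_{η-ε}`. -/
def Protocol.Learns {n d : ℕ} (T : Protocol n d)
    (A : Fin n → Finset (EuclideanSpace ℂ (Fin d))) (η ε δ : ℝ) : Prop :=
  ∀ ρ, IsDensity ρ →
    1 - δ ≤ T.prob ρ {S | goodStates A ρ η ⊆ S ∧ S ⊆ goodStates A ρ (η - ε)}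

/-! Part 1 rests on |𝒫| ≤ s^n and classical shadows. Let φ have independent entries z with E z = E
z² = E z|z|² = 0, E|z|² = 1 and E|z|⁴ = 2. Then E|φ⟩⟨φ| = 1, so the weighted operators |φ⟩⟨φ| form a
POVM whose outcome φ has density ⟨φ|ρ|φ⟩. For a unit vector v, fourth moments give |⟨v|φ⟩|² the mean
1 + ⟨v|ρ|v⟩ under this measurement (`shadowExp_fidelity_mul`), and sixth moments bound its second
moment by 10 in every dimension (`shadowExp_fidelity_mul_sq_le`). By Bernstein's inequality and a
union bound, O(log(|𝒫|/δ)/ε²) outcomes estimate all fidelities. Finally log|𝒫| ≤ ns, and the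
exponent of 10ns is at least 1.

The size bound in part 2 is a Gram matrix argument. Product states that differ in j positions
overlap by at most γ^j. Beyond a suitable Hamming radius the overlap is at most η/2, and a ball of
that radius is small, so a set G of good states has absolute Gram row sums at most ball + |G|η/2. A
Bessel inequality for such families bounds the sum of their fidelities, which is at least |G|η, by
the same number (`card_le_of_le_prefixFidelity`). This works equally for marginals on a set K of
positions.

The local algorithm uses that the marginal fidelity only decreases when positions are added. It
extends candidates position by position. At every level the size bound, applied at η - ε ≥ η/2,
limits the number of survivors; each has at most s extensions, and each extension is tested on fresh
copies in a product basis containing it, where its marginal fidelity is the probability of the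
outcome 0 on K. -/

/-! ### Density matrices and Born's rule. -/

theorem Matrix.PosSemidef.exists_eq_conjTranspose_mul_self {ι : Type*} [Fintype ι] [DecidableEq ι]
    {ρ : Matrix ι ι ℂ} (hρ : ρ.PosSemidef) : ∃ B : Matrix ι ι ℂ, ρ = B.conjTranspose * B := by
  open scoped MatrixOrder Matrix.Norms.L2Operator in
  obtain ⟨B, hB⟩ := CStarAlgebra.nonneg_iff_eq_star_mul_self.mp hρ.nonneg
  exact ⟨B, hB⟩

/-- A state is a sum of rank-one operators, given by the rows of a square root. -/
theorem IsDensity.exists_rows {n d : ℕ} {ρ : Matrix (Fin n → Fin d) (Fin n → Fin d) ℂ}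
    (hρ : IsDensity ρ) :
    ∃ b : (Fin n → Fin d) → EuclideanSpace ℂ (Fin n → Fin d),
      (∀ v, fidelity ρ v = ∑ r, ‖inner ℂ (b r) (WithLp.toLp 2 v)‖ ^ 2) ∧ ∑ r, ‖b r‖ ^ 2 = 1 := by
  obtain ⟨B, hB⟩ := hρ.1.exists_eq_conjTranspose_mul_self
  have hin : ∀ r v, inner ℂ (WithLp.toLp 2 (star (B r)) : EuclideanSpace ℂ (Fin n → Fin d))
      (WithLp.toLp 2 v) = B.mulVec v r := by
    intro r v
    simp [PiLp.inner_apply, Matrix.mulVec, dotProduct, mul_comm]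
  refine ⟨fun r => WithLp.toLp 2 (star (B r)), fun v => ?_, ?_⟩
  · have : star v ⬝ᵥ ρ.mulVec v = star (B.mulVec v) ⬝ᵥ B.mulVec v := by
      rw [hB, ← Matrix.mulVec_mulVec, Matrix.dotProduct_mulVec, Matrix.star_mulVec]
    rw [fidelity, this]
    simp only [hin, dotProduct, Complex.re_sum, Pi.star_apply]
    refine Finset.sum_congr rfl fun r _ => ?_
    rw [Complex.star_def, ← Complex.normSq_eq_conj_mul_self, Complex.ofReal_re,
      Complex.normSq_eq_norm_sq]
  · have h1 : (∑ r, ‖(WithLp.toLp 2 (star (B r)) : EuclideanSpace ℂ (Fin n → Fin d))‖ ^ 2 : ℝ)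
        = ρ.trace.re := by
      simp only [EuclideanSpace.norm_sq_eq, hB, Matrix.trace, Matrix.diag, Matrix.mul_apply,
        Complex.re_sum, Matrix.conjTranspose_apply]
      rw [Finset.sum_comm]
      refine Finset.sum_congr rfl fun x _ => Finset.sum_congr rfl fun r _ => ?_
      rw [Complex.star_def, ← Complex.normSq_eq_conj_mul_self, Complex.ofReal_re,
        Complex.normSq_eq_norm_sq]
      simp
    rw [h1, hρ.2, Complex.one_re]

theorem IsDensity.fidelity_nonneg {n d : ℕ} {ρ : Matrix (Fin n → Fin d) (Fin n → Fin d) ℂ}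
    (hρ : IsDensity ρ) (v : (Fin n → Fin d) → ℂ) : 0 ≤ fidelity ρ v := by
  obtain ⟨b, hb, -⟩ := hρ.exists_rows
  rw [hb]
  positivity

theorem trace_vecMulVec_mul {n d : ℕ} (ρ : Matrix (Fin n → Fin d) (Fin n → Fin d) ℂ)
    (v : (Fin n → Fin d) → ℂ) :
    (Matrix.vecMulVec v (star v) * ρ).trace.re = fidelity ρ v := by
  rw [fidelity, Matrix.vecMulVec_mul, Matrix.trace_vecMulVec, dotProduct_comm,
    ← Matrix.dotProduct_mulVec]

/-- The probability of an outcome of a measurement (Born's rule). -/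
noncomputable def Measurement.outcomeProb {n d m : ℕ} (M : Measurement n d m)
    (ρ : Matrix (Fin n → Fin d) (Fin n → Fin d) ℂ) (i : Fin m) : ℝ :=
  (M.effect i * ρ).trace.re

/-- With ρ = B*B, cyclicity turns the trace into that of the positive matrix B E B*. -/
theorem Measurement.outcomeProb_nonneg {n d m : ℕ} (M : Measurement n d m)
    {ρ : Matrix (Fin n → Fin d) (Fin n → Fin d) ℂ} (hρ : IsDensity ρ) (i : Fin m) :
    0 ≤ M.outcomeProb ρ i := by
  obtain ⟨B, hB⟩ := hρ.1.exists_eq_conjTranspose_mul_self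
  have h := ((M.posSemidef i).mul_mul_conjTranspose_same B).trace_nonneg
  have e : (M.effect i * ρ).trace = (B * M.effect i * B.conjTranspose).trace := by
    rw [hB, ← Matrix.mul_assoc, Matrix.trace_mul_comm, ← Matrix.mul_assoc]
  rw [outcomeProb, e]
  exact (Complex.le_def.mp h).1

theorem Measurement.sum_outcomeProb {n d m : ℕ} (M : Measurement n d m)
    {ρ : Matrix (Fin n → Fin d) (Fin n → Fin d) ℂ} (hρ : IsDensity ρ) :
    ∑ i, M.outcomeProb ρ i = 1 := by
  simp only [outcomeProb]
  rw [← Complex.re_sum, ← Matrix.trace_sum, ← Finset.sum_mul, M.sum_eq_one, one_mul, hρ.2,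
    Complex.one_re]

/-! ### Concentration along the tree of outcomes. -/

namespace Protocol

variable {n d : ℕ}

theorem prob_output_of_mem (ρ : Matrix (Fin n → Fin d) (Fin n → Fin d) ℂ)
    {good : Set (Set ((Fin n → Fin d) → ℂ))} {S : Set ((Fin n → Fin d) → ℂ)} (hS : S ∈ good) :
    (output S : Protocol n d).prob ρ good = 1 := by
  simp only [prob]
  rw [Set.indicator_of_mem hS, Pi.one_apply]

theorem prob_nonneg {ρ : Matrix (Fin n → Fin d) (Fin n → Fin d) ℂ} (hρ : IsDensity ρ)
    (good : Set (Set ((Fin n → Fin d) → ℂ))) (T : Protocol n d) : 0 ≤ T.prob ρ good := by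
  induction T with
  | output S => exact Set.indicator_nonneg (fun _ _ => zero_le_one) _
  | measure M next ih =>
    exact Finset.sum_nonneg fun i _ => mul_nonneg (M.outcomeProb_nonneg hρ i) (ih i)

/-- Do the measurement `M` on `N` copies, add up the values of the statistics `f` to `a`, and go on
with `K`. -/
noncomputable def accumulate {m : ℕ} {ι : Type*} (M : Measurement n d m) (f : Fin m → ι → ℝ)
    (K : (ι → ℝ) → Protocol n d) : ℕ → (ι → ℝ) → Protocol n d
  | 0, a => K a
  | N + 1, a => .measure M fun i => accumulate M f K N (a + f i)

theorem copies_accumulate_le {m : ℕ} {ι : Type*} (M : Measurement n d m) (f : Fin m → ι → ℝ)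
    (K : (ι → ℝ) → Protocol n d) {c : ℕ} (hK : ∀ b, (K b).copies ≤ c) (N : ℕ) (a : ι → ℝ) :
    (accumulate M f K N a).copies ≤ N + c := by
  induction N generalizing a with
  | zero => simpa [accumulate] using hK a
  | succ N ih =>
    have : (Finset.univ.sup fun i => (accumulate M f K N (a + f i)).copies) ≤ N + c :=
      Finset.sup_le fun i _ => ih _
    simp only [accumulate, copies]
    omega

theorem isLocal_accumulate {m : ℕ} {ι : Type*} {M : Measurement n d m} (hM : M.IsLocal)
    (f : Fin m → ι → ℝ) (K : (ι → ℝ) → Protocol n d) (hK : ∀ b, (K b).IsLocal) (N : ℕ)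
    (a : ι → ℝ) : (accumulate M f K N a).IsLocal := by
  induction N generalizing a with
  | zero => exact hK a
  | succ N ih => exact ⟨hM, fun i => ih _⟩

/-- Chernoff's argument without a probability space. The bound on the success probability, as a
function of the accumulated sum, is `q` minus exponential penalties for both tails and all
statistics. Averaging over one more outcome multiplies each penalty by a moment generating function,
at most exp(c) or exp(c'). -/
theorem le_prob_accumulate_aux {m : ℕ} {ι : Type*} [Fintype ι]
    {ρ : Matrix (Fin n → Fin d) (Fin n → Fin d) ℂ} (hρ : IsDensity ρ)
    (good : Set (Set ((Fin n → Fin d) → ℂ))) (M : Measurement n d m) (f : Fin m → ι → ℝ)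
    (K : (ι → ℝ) → Protocol n d) (q l : ℝ) (c c' θ θ' : ι → ℝ)
    (hc : ∀ x, ∑ i, M.outcomeProb ρ i * Real.exp (l * f i x) ≤ Real.exp (c x))
    (hc' : ∀ x, ∑ i, M.outcomeProb ρ i * Real.exp (-l * f i x) ≤ Real.exp (c' x))
    (hK : ∀ b, q - ∑ x, (Real.exp (l * b x + θ x) + Real.exp (-l * b x + θ' x))
      ≤ (K b).prob ρ good) (N : ℕ) (a : ι → ℝ) :
    q - ∑ x, (Real.exp (l * a x + θ x + N * c x) + Real.exp (-l * a x + θ' x + N * c' x))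
      ≤ (accumulate M f K N a).prob ρ good := by
  induction N generalizing a with
  | zero => simpa [accumulate] using hK a
  | succ N ih =>
    have step : ∀ i, M.outcomeProb ρ i * (q - ∑ x, (Real.exp (l * (a + f i) x + θ x + N * c x)
        + Real.exp (-l * (a + f i) x + θ' x + N * c' x)))
        ≤ M.outcomeProb ρ i * (accumulate M f K N (a + f i)).prob ρ good :=
      fun i => mul_le_mul_of_nonneg_left (ih _) (M.outcomeProb_nonneg hρ i)
    refine le_trans ?_ (Finset.sum_le_sum fun i _ => step i)
    have e : ∑ i, M.outcomeProb ρ i * (q - ∑ x, (Real.exp (l * (a + f i) x + θ x + N * c x)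
        + Real.exp (-l * (a + f i) x + θ' x + N * c' x)))
        = q - ∑ x, (Real.exp (l * a x + θ x + N * c x)
            * (∑ i, M.outcomeProb ρ i * Real.exp (l * f i x))
          + Real.exp (-l * a x + θ' x + N * c' x)
            * (∑ i, M.outcomeProb ρ i * Real.exp (-l * f i x))) := by
      simp only [mul_sub, Finset.sum_sub_distrib, ← Finset.sum_mul, M.sum_outcomeProb hρ, one_mul]
      congr 1
      simp only [Finset.mul_sum]
      rw [Finset.sum_comm]
      refine Finset.sum_congr rfl fun x _ => ?_
      rw [← Finset.sum_add_distrib]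
      refine Finset.sum_congr rfl fun i _ => ?_
      rw [show l * (a + f i) x + θ x + N * c x = (l * a x + θ x + N * c x) + l * f i x by
          simp only [Pi.add_apply]; ring,
        show -l * (a + f i) x + θ' x + N * c' x = (-l * a x + θ' x + N * c' x) + -l * f i x by
          simp only [Pi.add_apply]; ring, Real.exp_add, Real.exp_add (-l * a x + θ' x + N * c' x)]
      ring
    rw [e]
    refine sub_le_sub_left (Finset.sum_le_sum fun x _ => ?_) _
    rw [show l * a x + θ x + ((N + 1 : ℕ) : ℝ) * c x = (l * a x + θ x + N * c x) + c x by
        push_cast; ring,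
      show -l * a x + θ' x + ((N + 1 : ℕ) : ℝ) * c' x = (-l * a x + θ' x + N * c' x) + c' x by
        push_cast; ring, Real.exp_add (l * a x + θ x + N * c x),
      Real.exp_add (-l * a x + θ' x + N * c' x)]
    gcongr
    · exact hc x
    · exact hc' x

/-- Average exp(y) ≤ 1 + y + y², valid for |y| ≤ 1, and then use 1 + t ≤ exp(t). -/
theorem sum_mul_exp_le {m : ℕ} {p f : Fin m → ℝ} (hp : ∀ i, 0 ≤ p i) (hp1 : ∑ i, p i = 1)
    {l v : ℝ} (hf : ∀ i, |l * f i| ≤ 1) (hv : ∑ i, p i * f i ^ 2 ≤ v) :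
    ∑ i, p i * Real.exp (l * f i) ≤ Real.exp (l * ∑ i, p i * f i + l ^ 2 * v) := by
  have h : ∀ i, p i * Real.exp (l * f i) ≤ p i + l * (p i * f i) + l ^ 2 * (p i * f i ^ 2) := by
    intro i
    have h1 := Real.abs_exp_sub_one_sub_id_le (hf i)
    have h2 := (abs_le.mp h1).2
    have h3 : Real.exp (l * f i) ≤ 1 + l * f i + (l * f i) ^ 2 := by linarith
    calc p i * Real.exp (l * f i) ≤ p i * (1 + l * f i + (l * f i) ^ 2) :=
          mul_le_mul_of_nonneg_left h3 (hp i)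
      _ = _ := by ring
  refine (Finset.sum_le_sum fun i _ => h i).trans ?_
  rw [Finset.sum_add_distrib, Finset.sum_add_distrib, ← Finset.mul_sum, ← Finset.mul_sum, hp1]
  have := Real.add_one_le_exp (l * ∑ i, p i * f i + l ^ 2 * v)
  have := mul_le_mul_of_nonneg_left hv (sq_nonneg l)
  linarith

/-- Bernstein's inequality for the empirical means of bounded statistics of second moment at most
`v`, as a bound on the probability of success of an algorithm that uses them. -/
theorem le_prob_accumulate {m : ℕ} {ι : Type*} [Fintype ι]
    {ρ : Matrix (Fin n → Fin d) (Fin n → Fin d) ℂ} (hρ : IsDensity ρ)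
    (good : Set (Set ((Fin n → Fin d) → ℂ))) (M : Measurement n d m) (f : Fin m → ι → ℝ)
    (K : (ι → ℝ) → Protocol n d) {q l v τ : ℝ} (N : ℕ) (hq : q ≤ 1) (hl : 0 ≤ l)
    (hf : ∀ i x, |l * f i x| ≤ 1) (hv : ∀ x, ∑ i, M.outcomeProb ρ i * f i x ^ 2 ≤ v)
    (hK : ∀ b, (∀ x, |b x - N * ∑ i, M.outcomeProb ρ i * f i x| < N * τ) →
      q ≤ (K b).prob ρ good) :
    q - 2 * Fintype.card ι * Real.exp (-(N * (l * τ - l ^ 2 * v)))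
      ≤ (accumulate M f K N 0).prob ρ good := by
  set μ : ι → ℝ := fun x => ∑ i, M.outcomeProb ρ i * f i x with hμ
  -- The offsets are chosen so that a deviation of at least Nτ in either direction makes one penalty
  -- at least 1. The bound to be shown is then at most q - 1 ≤ 0, so it is trivial off the good
  -- event.
  have key := le_prob_accumulate_aux hρ good M f K q l (fun x => l * μ x + l ^ 2 * v)
    (fun x => -l * μ x + l ^ 2 * v) (fun x => -(l * N * (μ x + τ)))
    (fun x => l * N * (μ x - τ))
    (fun x => sum_mul_exp_le (M.outcomeProb_nonneg hρ) (M.sum_outcomeProb hρ)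
      (fun i => hf i x) (hv x))
    (fun x => by
      have := sum_mul_exp_le (f := fun i => f i x) (l := -l) (M.outcomeProb_nonneg hρ)
        (M.sum_outcomeProb hρ) (fun i => by rw [neg_mul, abs_neg]; exact hf i x) (hv x)
      rwa [neg_sq] at this)
    (fun b => by
      by_cases hb : ∀ x, |b x - N * μ x| < N * τ
      · have h1 := hK b hb
        have h2 : 0 ≤ ∑ x, (Real.exp (l * b x + -(l * N * (μ x + τ)))
            + Real.exp (-l * b x + l * N * (μ x - τ))) :=
          Finset.sum_nonneg fun x _ => by positivity
        linarith
      · push Not at hb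
        obtain ⟨x, hx⟩ := hb
        have h1 := Finset.single_le_sum (f := fun x => Real.exp (l * b x + -(l * N * (μ x + τ)))
            + Real.exp (-l * b x + l * N * (μ x - τ))) (fun x _ => by positivity)
            (Finset.mem_univ x)
        have h2 := prob_nonneg hρ good (K b)
        have h3 : 1 ≤ Real.exp (l * b x + -(l * N * (μ x + τ)))
            + Real.exp (-l * b x + l * N * (μ x - τ)) := by
          rcases le_abs.mp hx with h | h
          · have : 1 ≤ Real.exp (l * b x + -(l * N * (μ x + τ))) := by
              apply Real.one_le_exp
              have := mul_nonneg hl (sub_nonneg.mpr h)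
              linarith
            have := Real.exp_pos (-l * b x + l * N * (μ x - τ))
            linarith
          · have : 1 ≤ Real.exp (-l * b x + l * N * (μ x - τ)) := by
              apply Real.one_le_exp
              have := mul_nonneg hl (sub_nonneg.mpr h)
              linarith
            have := Real.exp_pos (l * b x + -(l * N * (μ x + τ)))
            linarith
        linarith) N 0
  refine le_trans (le_of_eq ?_) key
  congr 1
  rw [Finset.sum_congr rfl (g := fun _ => 2 * Real.exp (-(N * (l * τ - l ^ 2 * v))))
    (fun x _ => ?_)]
  · simp; ring
  · rw [two_mul]
    congr 2
    · simp only [Pi.zero_apply]; ring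
    · simp only [Pi.zero_apply]; ring

end Protocol

/-! ### Moments of a random vector with five-valued entries. -/

/-- The values of a complex random variable that agrees with a standard Gaussian in the moments of
order at most four. -/
noncomputable def shadowNode : Fin 5 → ℂ :=
  ![0, 1 + Complex.I, 1 - Complex.I, -1 + Complex.I, -1 - Complex.I]

/-- The probabilities of the values `shadowNode`. -/
noncomputable def shadowWeight : Fin 5 → ℝ := ![1 / 2, 1 / 8, 1 / 8, 1 / 8, 1 / 8]

/-- The random vector with independent entries distributed as `shadowNode`, as a function of the
sample point. -/
noncomputable def shadowVec {ι : Type*} (o : ι → Fin 5) : ι → ℂ := fun x => shadowNode (o x)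

/-- Expectation over the random vector `shadowVec`. -/
noncomputable def shadowExp {ι : Type*} [Fintype ι] [DecidableEq ι] (g : (ι → ℂ) → ℝ) : ℝ :=
  ∑ o : ι → Fin 5, (∏ x, shadowWeight (o x)) * g (shadowVec o)

theorem shadowWeight_nonneg (j : Fin 5) : 0 ≤ shadowWeight j := by
  fin_cases j <;> norm_num [shadowWeight]

/-- The linear form given by the inner product with `u`. -/
noncomputable def linForm {ι : Type*} [Fintype ι] (u φ : ι → ℂ) : ℂ := ∑ x, star (u x) * φ x

section

variable {ι : Type*} [Fintype ι] [DecidableEq ι]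

theorem shadowExp_mono {g h : (ι → ℂ) → ℝ} (H : ∀ φ, g φ ≤ h φ) : shadowExp g ≤ shadowExp h :=
  Finset.sum_le_sum fun _ _ =>
    mul_le_mul_of_nonneg_left (H _) (Finset.prod_nonneg fun _ _ => shadowWeight_nonneg _)

theorem shadowExp_add (g h : (ι → ℂ) → ℝ) :
    shadowExp (fun φ => g φ + h φ) = shadowExp g + shadowExp h := by
  simp [shadowExp, mul_add, Finset.sum_add_distrib]

theorem shadowExp_mul (c : ℝ) (g : (ι → ℂ) → ℝ) :
    shadowExp (fun φ => c * g φ) = c * shadowExp g := by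
  simp only [shadowExp, Finset.mul_sum]
  exact Finset.sum_congr rfl fun _ _ => by ring

theorem shadowExp_const (c : ℝ) : shadowExp (fun _ : ι → ℂ => c) = c := by
  have : ∑ o : ι → Fin 5, (∏ x, shadowWeight (o x)) = 1 := by
    have h : ∑ j, shadowWeight j = 1 := by
      simp [Fin.sum_univ_five, shadowWeight]; norm_num
    have := Finset.prod_univ_sum (fun _ : ι => (Finset.univ : Finset (Fin 5)))
      (fun _ j => shadowWeight j)
    rw [Fintype.piFinset_univ] at this
    rw [← this]
    simp [h]
  simp [shadowExp, ← Finset.sum_mul, this]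

theorem shadowExp_equiv {κ : Type*} [Fintype κ] [DecidableEq κ] (e : ι ≃ κ) (g : (κ → ℂ) → ℝ) :
    shadowExp (fun φ => g (φ ∘ e.symm)) = shadowExp g := by
  refine Fintype.sum_equiv (Equiv.arrowCongr e (Equiv.refl _)) _ _ fun o => ?_
  congr 1
  exact Fintype.prod_equiv e _ _ fun x => by simp

end

theorem linForm_comp {ι κ : Type*} [Fintype ι] [Fintype κ] (e : ι ≃ κ) (u φ : ι → ℂ) :
    linForm (u ∘ e.symm) (φ ∘ e.symm) = linForm u φ :=
  (Fintype.sum_equiv e _ _ fun x => by simp).symm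

theorem shadowExp_succ {D : ℕ} (g : (Fin (D + 1) → ℂ) → ℝ) :
    shadowExp g = ∑ j, shadowWeight j *
      shadowExp (fun φ : Fin D → ℂ => g (Fin.cons (shadowNode j) φ)) := by
  have : shadowExp g = ∑ q : Fin 5 × (Fin D → Fin 5),
      (shadowWeight q.1 * ∏ x, shadowWeight (q.2 x)) * g (shadowVec (Fin.cons q.1 q.2)) := by
    refine (Fintype.sum_equiv (Fin.consEquiv fun _ => Fin 5) _ _ fun q => ?_).symm
    simp [Fin.consEquiv, Fin.prod_univ_succ]
  rw [this, Fintype.sum_prod_type]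
  refine Finset.sum_congr rfl fun j _ => ?_
  rw [shadowExp, Finset.mul_sum]
  refine Finset.sum_congr rfl fun o _ => ?_
  have e : shadowVec (Fin.cons j o : Fin (D + 1) → Fin 5)
      = Fin.cons (shadowNode j) (shadowVec o) := by
    funext x
    refine Fin.cases ?_ (fun x => ?_) x <;> simp [shadowVec]
  rw [e, mul_assoc]

theorem linForm_cons {D : ℕ} (u : Fin (D + 1) → ℂ) (z : ℂ) (φ : Fin D → ℂ) :
    linForm u (Fin.cons z φ) = star (u 0) * z + linForm (Fin.tail u) φ := by
  simp [linForm, Fin.sum_univ_succ, Fin.tail]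

theorem shadowExp_succ' {D : ℕ} (g : (Fin (D + 1) → ℂ) → ℝ) :
    shadowExp g = shadowExp (fun φ : Fin D → ℂ =>
      ∑ j, shadowWeight j * g (Fin.cons (shadowNode j) φ)) := by
  rw [shadowExp_succ]
  simp only [shadowExp, Finset.mul_sum]
  rw [Finset.sum_comm]
  exact Finset.sum_congr rfl fun o _ => Finset.sum_congr rfl fun j _ => by ring

/-- Uses E z = 0 and E|z|² = 1. Expectations here are real, so the factor `c` lets one real identity
carry a complex one: c = 1 and c = -i yield the two parts. -/
theorem shadowNode_first (c u v X Y : ℂ) :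
    ∑ j, shadowWeight j * (c * (star (star u * shadowNode j + X)
      * (star v * shadowNode j + Y))).re = (c * (star X * Y)).re + (c * (u * star v)).re := by
  simp [Fin.sum_univ_five, shadowWeight, shadowNode]
  ring

/-- Only monomials of degree at most two in z and at most two in its conjugate occur. On these the
five-point law agrees with a standard complex Gaussian; in particular E z² = 0 and E|z|⁴ = 2. -/
theorem shadowNode_second (u v X Y : ℂ) :
    ∑ j, shadowWeight j * (Complex.normSq (star u * shadowNode j + X)
      * Complex.normSq (star v * shadowNode j + Y)) =
      Complex.normSq X * Complex.normSq Y + Complex.normSq v * Complex.normSq X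
      + Complex.normSq u * Complex.normSq Y + 2 * (Complex.normSq u * Complex.normSq v)
      + 2 * ((star u * v) * (star X * Y)).re := by
  simp [Fin.sum_univ_five, shadowWeight, shadowNode, Complex.normSq_apply]
  ring

/-- With a = |X|², b = |s|² and c = 2 Re(s̄X), the left side is 2(a+b)³ + 6(a+b)c², and c² ≤ 4ab by
Cauchy–Schwarz. -/
theorem normSq_add_cube_add_normSq_sub_cube_le (X s : ℂ) :
    Complex.normSq (s + X) ^ 3 + Complex.normSq (-s + X) ^ 3 ≤
      2 * (Complex.normSq X ^ 3 + 15 * Complex.normSq X ^ 2 * Complex.normSq s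
        + 15 * Complex.normSq X * Complex.normSq s ^ 2 + Complex.normSq s ^ 3) := by
  set a := Complex.normSq X with ha
  set b := Complex.normSq s with hb
  have ha0 : 0 ≤ a := Complex.normSq_nonneg _
  have hb0 : 0 ≤ b := Complex.normSq_nonneg _
  set c := 2 * (s.re * X.re + s.im * X.im) with hc
  have h1 : Complex.normSq (s + X) = a + b + c := by
    simp only [ha, hb, hc, Complex.normSq_apply, Complex.add_re, Complex.add_im]; ring
  have h2 : Complex.normSq (-s + X) = a + b - c := by
    simp only [ha, hb, hc, Complex.normSq_apply, Complex.add_re, Complex.add_im, Complex.neg_re,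
      Complex.neg_im]; ring
  have h3 : c ^ 2 ≤ 4 * (a * b) := by
    have : 4 * (a * b) - c ^ 2 = 4 * (s.re * X.im - s.im * X.re) ^ 2 := by
      simp only [ha, hb, hc, Complex.normSq_apply]; ring
    nlinarith [sq_nonneg (s.re * X.im - s.im * X.re)]
  rw [h1, h2]
  nlinarith [mul_le_mul_of_nonneg_left h3 (add_nonneg ha0 hb0)]

/-- The nonzero nodes form two antipodal pairs with |z|² = 2; the preceding inequality applies to
each pair. -/
theorem shadowNode_third (u X : ℂ) :
    ∑ j, shadowWeight j * Complex.normSq (star u * shadowNode j + X) ^ 3 ≤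
      Complex.normSq X ^ 3 + 15 * Complex.normSq u * Complex.normSq X ^ 2
        + 30 * Complex.normSq u ^ 2 * Complex.normSq X + 4 * Complex.normSq u ^ 3 := by
  have h1 := normSq_add_cube_add_normSq_sub_cube_le X (star u * (1 + Complex.I))
  have h2 := normSq_add_cube_add_normSq_sub_cube_le X (star u * (1 - Complex.I))
  have e1 : Complex.normSq (star u * (1 + Complex.I)) = 2 * Complex.normSq u := by
    simp [Complex.normSq_apply]; ring
  have e2 : Complex.normSq (star u * (1 - Complex.I)) = 2 * Complex.normSq u := by
    simp [Complex.normSq_apply]; ring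
  rw [e1] at h1
  rw [e2] at h2
  have e3 : -(star u * (1 + Complex.I)) = star u * (-1 - Complex.I) := by ring
  have e4 : -(star u * (1 - Complex.I)) = star u * (-1 + Complex.I) := by ring
  rw [e3] at h1
  rw [e4] at h2
  have e : ∑ j, shadowWeight j * Complex.normSq (star u * shadowNode j + X) ^ 3 =
      1 / 2 * Complex.normSq X ^ 3
      + 1 / 8 * Complex.normSq (star u * (1 + Complex.I) + X) ^ 3
      + 1 / 8 * Complex.normSq (star u * (1 - Complex.I) + X) ^ 3
      + 1 / 8 * Complex.normSq (star u * (-1 + Complex.I) + X) ^ 3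
      + 1 / 8 * Complex.normSq (star u * (-1 - Complex.I) + X) ^ 3 := by
    simp [Fin.sum_univ_five, shadowWeight, shadowNode]
  rw [e]
  nlinarith

theorem shadowExp_first_fin {D : ℕ} (c : ℂ) (u v : Fin D → ℂ) :
    shadowExp (fun φ => (c * (star (linForm u φ) * linForm v φ)).re)
      = (c * linForm v u).re := by
  induction D with
  | zero => simp [shadowExp, linForm]
  | succ D ih =>
    rw [shadowExp_succ']
    simp only [linForm_cons, shadowNode_first]
    rw [shadowExp_add, ih, shadowExp_const]
    rw [← Complex.add_re, ← mul_add]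
    congr 2
    simp [linForm, Fin.sum_univ_succ, Fin.tail]
    ring

theorem linForm_self {ι : Type*} [Fintype ι] (u : ι → ℂ) :
    linForm u u = ((∑ x, Complex.normSq (u x) : ℝ) : ℂ) := by
  simp [linForm, Complex.normSq_eq_conj_mul_self]

theorem shadowExp_normSq_fin {D : ℕ} (u : Fin D → ℂ) :
    shadowExp (fun φ => Complex.normSq (linForm u φ)) = ∑ x, Complex.normSq (u x) := by
  have h := shadowExp_first_fin 1 u u
  rw [one_mul, linForm_self, Complex.ofReal_re] at h
  rw [← h]
  congr 1
  funext φ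
  rw [one_mul, Complex.star_def, ← Complex.normSq_eq_conj_mul_self, Complex.ofReal_re]

theorem shadowExp_second_fin {D : ℕ} (u v : Fin D → ℂ) :
    shadowExp (fun φ => Complex.normSq (linForm u φ) * Complex.normSq (linForm v φ))
      = (∑ x, Complex.normSq (u x)) * (∑ x, Complex.normSq (v x))
        + Complex.normSq (linForm u v) := by
  induction D with
  | zero => simp [shadowExp, linForm]
  | succ D ih =>
    rw [shadowExp_succ']
    simp only [linForm_cons, shadowNode_second]
    rw [shadowExp_add, shadowExp_add, shadowExp_add, shadowExp_add, shadowExp_mul, shadowExp_mul,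
      shadowExp_mul, ih, shadowExp_const, shadowExp_mul, shadowExp_normSq_fin,
      shadowExp_normSq_fin,
      shadowExp_first_fin]
    have e : linForm u v = star (u 0) * v 0 + linForm (Fin.tail u) (Fin.tail v) := by
      simp [linForm, Fin.sum_univ_succ, Fin.tail]
    have e' : linForm (Fin.tail v) (Fin.tail u) = star (linForm (Fin.tail u) (Fin.tail v)) := by
      simp [linForm, mul_comm]
    rw [e, e', Complex.normSq_add, Fin.sum_univ_succ, Fin.sum_univ_succ]
    simp only [Fin.tail, map_mul, Complex.star_def, Complex.normSq_conj]
    ring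

/-- The constant 10 is what the induction needs: with S the sum over the tail and a the new term,
the step adds 30aS² + 30a²S + 4a³, and 10(S+a)³ - 10S³ = 30aS² + 30a²S + 10a³. -/
theorem shadowExp_third_fin {D : ℕ} (u : Fin D → ℂ) :
    shadowExp (fun φ => Complex.normSq (linForm u φ) ^ 3)
      ≤ 10 * (∑ x, Complex.normSq (u x)) ^ 3 := by
  induction D with
  | zero => simp [shadowExp, linForm]
  | succ D ih =>
    rw [shadowExp_succ']
    simp only [linForm_cons]
    refine (shadowExp_mono fun φ => shadowNode_third _ _).trans ?_
    rw [shadowExp_add, shadowExp_add, shadowExp_add, shadowExp_mul, shadowExp_mul,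
      shadowExp_const, shadowExp_normSq_fin]
    have h2 := shadowExp_second_fin (Fin.tail u) (Fin.tail u)
    simp only [← sq] at h2
    rw [h2, linForm_self, Complex.normSq_ofReal, Fin.sum_univ_succ]
    have h := ih (Fin.tail u)
    simp only [Fin.tail] at h ⊢
    set a := Complex.normSq (u 0)
    set S := ∑ x : Fin D, Complex.normSq (u x.succ)
    have ha : 0 ≤ a := Complex.normSq_nonneg _
    nlinarith [pow_nonneg ha 3]

section

variable {ι : Type*} [Fintype ι] [DecidableEq ι]

theorem shadowExp_first (c : ℂ) (u v : ι → ℂ) :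
    shadowExp (fun φ => (c * (star (linForm u φ) * linForm v φ)).re)
      = (c * linForm v u).re := by
  let e := Fintype.equivFin ι
  have h := shadowExp_first_fin c (u ∘ e.symm) (v ∘ e.symm)
  rw [← shadowExp_equiv e] at h
  simpa only [linForm_comp] using h

theorem shadowExp_second (u v : ι → ℂ) :
    shadowExp (fun φ => Complex.normSq (linForm u φ) * Complex.normSq (linForm v φ))
      = (∑ x, Complex.normSq (u x)) * (∑ x, Complex.normSq (v x))
        + Complex.normSq (linForm u v) := by
  let e := Fintype.equivFin ι
  have h := shadowExp_second_fin (u ∘ e.symm) (v ∘ e.symm)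
  rw [← shadowExp_equiv e] at h
  simp only [linForm_comp, Function.comp_apply] at h
  rwa [e.symm.sum_comp fun x => Complex.normSq (u x),
    e.symm.sum_comp fun x => Complex.normSq (v x)] at h

theorem shadowExp_third (u : ι → ℂ) :
    shadowExp (fun φ => Complex.normSq (linForm u φ) ^ 3)
      ≤ 10 * (∑ x, Complex.normSq (u x)) ^ 3 := by
  let e := Fintype.equivFin ι
  have h := shadowExp_third_fin (u ∘ e.symm)
  rw [← shadowExp_equiv e] at h
  simp only [linForm_comp, Function.comp_apply] at h
  rwa [e.symm.sum_comp fun x => Complex.normSq (u x)] at h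

/-- Weighted AM-GM reduces the mixed moment to pure sixth moments: ts² ≤ (2s³ + t³)/3, where t is
|⟨u|φ⟩|² normalized by |u|². -/
theorem shadowExp_mixed_le (u v : ι → ℂ) (hv : ∑ x, Complex.normSq (v x) = 1) :
    shadowExp (fun φ => Complex.normSq (linForm u φ) * Complex.normSq (linForm v φ) ^ 2)
      ≤ 10 * ∑ x, Complex.normSq (u x) := by
  set β := ∑ x, Complex.normSq (u x) with hβ
  have hβ0 : 0 ≤ β := Finset.sum_nonneg fun _ _ => Complex.normSq_nonneg _
  rcases hβ0.eq_or_lt with h0 | h0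
  · have hu : u = 0 := by
      funext x
      have := (Finset.sum_eq_zero_iff_of_nonneg
        (fun x _ => Complex.normSq_nonneg (u x))).mp h0.symm x (Finset.mem_univ x)
      exact Complex.normSq_eq_zero.mp this
    rw [← h0]
    simp [hu, linForm, shadowExp]
  · have key : ∀ φ : ι → ℂ, Complex.normSq (linForm u φ) * Complex.normSq (linForm v φ) ^ 2 ≤
        (2 * β / 3) * Complex.normSq (linForm v φ) ^ 3
          + (1 / (3 * β ^ 2)) * Complex.normSq (linForm u φ) ^ 3 := by
      intro φ
      obtain ⟨t, ht⟩ : ∃ t, t = Complex.normSq (linForm u φ) / β := ⟨_, rfl⟩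
      have hX : Complex.normSq (linForm u φ) = β * t := by rw [ht]; field_simp
      have ht0 : 0 ≤ t := by rw [ht]; exact div_nonneg (Complex.normSq_nonneg _) hβ0
      have hs := Complex.normSq_nonneg (linForm v φ)
      set s := Complex.normSq (linForm v φ)
      rw [hX]
      have e : (2 * β / 3) * s ^ 3 + (1 / (3 * β ^ 2)) * (β * t) ^ 3 - β * t * s ^ 2
          = β / 3 * ((s - t) ^ 2 * (2 * s + t)) := by
        field_simp
        ring
      have : 0 ≤ β / 3 * ((s - t) ^ 2 * (2 * s + t)) := by positivity
      linarith
    refine (shadowExp_mono key).trans ?_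
    rw [shadowExp_add, shadowExp_mul, shadowExp_mul]
    have h1 := shadowExp_third v
    have h2 := shadowExp_third u
    rw [hv] at h1
    rw [← hβ] at h2
    have h3 := mul_le_mul_of_nonneg_left h1 (show 0 ≤ 2 * β / 3 by positivity)
    have h4 := mul_le_mul_of_nonneg_left h2 (show 0 ≤ 1 / (3 * β ^ 2) by positivity)
    have e : 1 / (3 * β ^ 2) * (10 * β ^ 3) = 10 / 3 * β := by field_simp
    rw [e] at h4
    linarith

end

/-! ### The shadow measurement and its statistics. -/

/-- The measurement with the effects `𝔼[|φ⟩⟨φ|; φ = φₒ]` for the random vector `shadowVec`. -/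
noncomputable def shadowMeasurement (n d : ℕ) :
    Measurement n d (Fintype.card ((Fin n → Fin d) → Fin 5)) where
  effect i :=
    let o := (Fintype.equivFin ((Fin n → Fin d) → Fin 5)).symm i
    ((∏ x, shadowWeight (o x) : ℝ) : ℂ) • Matrix.vecMulVec (shadowVec o) (star (shadowVec o))
  posSemidef i := by
    refine (Matrix.posSemidef_vecMulVec_self_star _).smul ?_
    exact Complex.zero_le_real.mpr (Finset.prod_nonneg fun _ _ => shadowWeight_nonneg _)
  sum_eq_one := by
    have main : ∀ (c : ℂ) (x y : Fin n → Fin d),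
        (c * ∑ o : (Fin n → Fin d) → Fin 5, ((∏ x, shadowWeight (o x) : ℝ) : ℂ) *
          (shadowVec o x * star (shadowVec o y))).re
          = (c * (1 : Matrix (Fin n → Fin d) (Fin n → Fin d) ℂ) x y).re := by
      intro c x y
      have h := shadowExp_first c (Pi.single y 1 : (Fin n → Fin d) → ℂ) (Pi.single x 1)
      have e : ∀ (z : Fin n → Fin d) (φ : (Fin n → Fin d) → ℂ),
          linForm (Pi.single z 1) φ = φ z := by
        intro z φ
        rw [linForm, Finset.sum_eq_single z]
        · simp
        · intro b _ hb
          simp [hb]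
        · simp
      simp only [e] at h
      rw [show (1 : Matrix (Fin n → Fin d) (Fin n → Fin d) ℂ) x y
        = (Pi.single y 1 : (Fin n → Fin d) → ℂ) x by
          simp [Matrix.one_apply, Pi.single_apply], ← h, shadowExp, Finset.mul_sum,
        Complex.re_sum]
      refine Finset.sum_congr rfl fun o _ => ?_
      rw [← Complex.re_ofReal_mul]
      congr 1
      ring
    rw [Equiv.sum_comp (Fintype.equivFin ((Fin n → Fin d) → Fin 5)).symm
      (fun o : (Fin n → Fin d) → Fin 5 => ((∏ x, shadowWeight (o x) : ℝ) : ℂ) •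
        Matrix.vecMulVec (shadowVec o) (star (shadowVec o)))]
    ext x y
    rw [Matrix.sum_apply]
    simp only [Matrix.smul_apply, Matrix.vecMulVec_apply, Pi.star_apply, smul_eq_mul]
    apply Complex.ext
    · simpa using main 1 x y
    · have := main (-Complex.I) x y
      simpa only [neg_mul, Complex.neg_re, Complex.I_mul_re, neg_neg] using this

theorem sum_shadowMeasurement {n d : ℕ} (ρ : Matrix (Fin n → Fin d) (Fin n → Fin d) ℂ)
    (g : ((Fin n → Fin d) → ℂ) → ℝ) :
    ∑ i, (shadowMeasurement n d).outcomeProb ρ i *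
        g (shadowVec ((Fintype.equivFin ((Fin n → Fin d) → Fin 5)).symm i))
      = shadowExp fun φ => fidelity ρ φ * g φ := by
  rw [shadowExp, ← Equiv.sum_comp (Fintype.equivFin ((Fin n → Fin d) → Fin 5)).symm]
  refine Finset.sum_congr rfl fun i _ => ?_
  rw [Measurement.outcomeProb, shadowMeasurement, Matrix.smul_mul, Matrix.trace_smul, smul_eq_mul,
    Complex.re_ofReal_mul, trace_vecMulVec_mul, mul_assoc]

theorem inner_productState {n d : ℕ} (p q : Fin n → EuclideanSpace ℂ (Fin d)) :
    inner ℂ (WithLp.toLp 2 (productState p) : EuclideanSpace ℂ (Fin n → Fin d))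
      (WithLp.toLp 2 (productState q)) = ∏ k, inner ℂ (p k) (q k) := by
  simp only [PiLp.inner_apply, productState]
  rw [Finset.prod_univ_sum, Fintype.piFinset_univ]
  refine Finset.sum_congr rfl fun x _ => ?_
  simp [Finset.prod_mul_distrib]

theorem norm_productState {n d : ℕ} {p : Fin n → EuclideanSpace ℂ (Fin d)}
    (hp : ∀ k, ‖p k‖ = 1) :
    ‖(WithLp.toLp 2 (productState p) : EuclideanSpace ℂ (Fin n → Fin d))‖ = 1 := by
  have h := inner_productState p p
  simp only [inner_self_eq_norm_sq_to_K, hp] at h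
  simp only [Complex.coe_algebraMap, Complex.ofReal_one, one_pow, Finset.prod_const_one] at h
  have h' : ‖(WithLp.toLp 2 (productState p) : EuclideanSpace ℂ (Fin n → Fin d))‖ ^ 2 = 1 := by
    exact_mod_cast h
  exact (pow_eq_one_iff_of_nonneg (norm_nonneg _) two_ne_zero).mp h'

theorem linForm_eq_inner {ι : Type*} [Fintype ι] (u φ : ι → ℂ) :
    linForm u φ = inner ℂ (WithLp.toLp 2 u : EuclideanSpace ℂ ι) (WithLp.toLp 2 φ) := by
  simp [linForm, PiLp.inner_apply, mul_comm]

theorem sum_normSq_eq_norm_sq {ι : Type*} [Fintype ι] (u : EuclideanSpace ℂ ι) :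
    ∑ x, Complex.normSq (u x) = ‖u‖ ^ 2 := by
  simp [EuclideanSpace.norm_sq_eq, Complex.normSq_eq_norm_sq]

theorem IsDensity.exists_linForm {n d : ℕ} {ρ : Matrix (Fin n → Fin d) (Fin n → Fin d) ℂ}
    (hρ : IsDensity ρ) :
    ∃ b : (Fin n → Fin d) → (Fin n → Fin d) → ℂ,
      (∀ v, fidelity ρ v = ∑ r, Complex.normSq (linForm (b r) v)) ∧
        ∑ r, ∑ x, Complex.normSq (b r x) = 1 := by
  obtain ⟨b, hb, hb1⟩ := hρ.exists_rows
  refine ⟨fun r => (b r).ofLp, fun v => ?_, ?_⟩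
  · rw [hb]
    exact Finset.sum_congr rfl fun r _ => by rw [linForm_eq_inner, Complex.normSq_eq_norm_sq]
  · rw [← hb1]
    exact Finset.sum_congr rfl fun r _ => sum_normSq_eq_norm_sq _

theorem shadowExp_sum {ι κ : Type*} [Fintype ι] [DecidableEq ι] (s : Finset κ)
    (g : κ → (ι → ℂ) → ℝ) :
    shadowExp (fun φ => ∑ r ∈ s, g r φ) = ∑ r ∈ s, shadowExp (g r) := by
  simp only [shadowExp, Finset.mul_sum]
  rw [Finset.sum_comm]

/-- Each row b of a square root of ρ contributes |b|² + |⟨b|v⟩|². Since an outcome φ has density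
⟨φ|ρ|φ⟩, the statistic |⟨v|φ⟩|² estimates the fidelity of v with the known offset 1. -/
theorem shadowExp_fidelity_mul {n d : ℕ} {ρ : Matrix (Fin n → Fin d) (Fin n → Fin d) ℂ}
    (hρ : IsDensity ρ) {v : (Fin n → Fin d) → ℂ} (hv : ∑ x, Complex.normSq (v x) = 1) :
    shadowExp (fun φ => fidelity ρ φ * Complex.normSq (linForm v φ)) = 1 + fidelity ρ v := by
  obtain ⟨b, hb, hb1⟩ := hρ.exists_linForm
  simp only [hb, Finset.sum_mul]
  rw [shadowExp_sum]
  simp only [shadowExp_second, hv, mul_one]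
  rw [Finset.sum_add_distrib, hb1]

theorem shadowExp_fidelity_mul_sq_le {n d : ℕ} {ρ : Matrix (Fin n → Fin d) (Fin n → Fin d) ℂ}
    (hρ : IsDensity ρ) {v : (Fin n → Fin d) → ℂ} (hv : ∑ x, Complex.normSq (v x) = 1) :
    shadowExp (fun φ => fidelity ρ φ * Complex.normSq (linForm v φ) ^ 2) ≤ 10 := by
  obtain ⟨b, hb, hb1⟩ := hρ.exists_linForm
  simp only [hb, Finset.sum_mul]
  rw [shadowExp_sum]
  refine (Finset.sum_le_sum fun r _ => shadowExp_mixed_le (b r) v hv).trans ?_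
  rw [← Finset.mul_sum, hb1, mul_one]

/-! ### Learning from shadows. -/

/-- All fidelities with a finite family of unit vectors can be estimated from
`O(log(size/δ)/ε²)` copies, each of which is measured by the same measurement. -/
theorem exists_protocol_of_fintype {n d : ℕ} {ι : Type*} [Fintype ι]
    (v : ι → (Fin n → Fin d) → ℂ) (hv : ∀ p, ∑ x, Complex.normSq (v p x) = 1)
    {η ε δ : ℝ} (hε : 0 < ε) (N : ℕ)
    (hN : 2 * Fintype.card ι * Real.exp (-(N * (ε ^ 2 / 640))) ≤ δ) :
    ∃ T : Protocol n d, T.copies ≤ N ∧ ∀ ρ, IsDensity ρ →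
      1 - δ ≤ T.prob ρ {S | (∀ p, η ≤ fidelity ρ (v p) → v p ∈ S) ∧
        ∀ w ∈ S, ∃ p, w = v p ∧ η - ε ≤ fidelity ρ (v p)} := by
  -- Bernstein's inequality needs bounded statistics. Since X ≤ min(X, T) + X²/T and the second
  -- moment is at most 10, truncation at T = 80/ε lowers the mean by at most ε/8.
  let f : Fin (Fintype.card ((Fin n → Fin d) → Fin 5)) → ι → ℝ := fun i p =>
    min (Complex.normSq (linForm (v p)
      (shadowVec ((Fintype.equivFin ((Fin n → Fin d) → Fin 5)).symm i)))) (80 / ε)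
  let K : (ι → ℝ) → Protocol n d := fun b =>
    .output {w | ∃ p, w = v p ∧ N * (1 + η - ε / 2) ≤ b p}
  refine ⟨Protocol.accumulate (shadowMeasurement n d) f K N 0, ?_, fun ρ hρ => ?_⟩
  · exact (Protocol.copies_accumulate_le _ f K (c := 0) (fun b => le_of_eq rfl) N 0).trans
      (by simp)
  have hT : 0 < 80 / ε := by positivity
  have hf0 : ∀ i p, 0 ≤ f i p := fun i p => le_min (Complex.normSq_nonneg _) hT.le
  have hμ : ∀ p, ∑ i, (shadowMeasurement n d).outcomeProb ρ i * f i p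
      = shadowExp fun φ => fidelity ρ φ * min (Complex.normSq (linForm (v p) φ)) (80 / ε) :=
    fun p => sum_shadowMeasurement ρ fun φ => min (Complex.normSq (linForm (v p) φ)) (80 / ε)
  have hup : ∀ p, ∑ i, (shadowMeasurement n d).outcomeProb ρ i * f i p
      ≤ 1 + fidelity ρ (v p) := by
    intro p
    rw [hμ, ← shadowExp_fidelity_mul hρ (hv p)]
    exact shadowExp_mono fun φ =>
      mul_le_mul_of_nonneg_left (min_le_left _ _) (hρ.fidelity_nonneg φ)
  have hlow : ∀ p, 1 + fidelity ρ (v p) - ε / 8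
      ≤ ∑ i, (shadowMeasurement n d).outcomeProb ρ i * f i p := by
    intro p
    have h1 := shadowExp_fidelity_mul hρ (hv p)
    have h2 := shadowExp_fidelity_mul_sq_le hρ (hv p)
    have key : ∀ φ, fidelity ρ φ * Complex.normSq (linForm (v p) φ) ≤
        fidelity ρ φ * min (Complex.normSq (linForm (v p) φ)) (80 / ε)
          + ε / 80 * (fidelity ρ φ * Complex.normSq (linForm (v p) φ) ^ 2) := by
      intro φ
      have h := hρ.fidelity_nonneg φ
      have hX := Complex.normSq_nonneg (linForm (v p) φ)
      set X := Complex.normSq (linForm (v p) φ)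
      have : X ≤ min X (80 / ε) + ε / 80 * X ^ 2 := by
        rcases le_total X (80 / ε) with hle | hle
        · rw [min_eq_left hle]
          have : 0 ≤ ε / 80 * X ^ 2 := by positivity
          linarith
        · have h1 : 1 ≤ ε / 80 * X := by
            calc (1 : ℝ) = ε / 80 * (80 / ε) := by field_simp
              _ ≤ _ := mul_le_mul_of_nonneg_left hle (by positivity)
          rw [min_eq_right hle]
          nlinarith
      calc fidelity ρ φ * X ≤ fidelity ρ φ * (min X (80 / ε) + ε / 80 * X ^ 2) :=
            mul_le_mul_of_nonneg_left this h
        _ = _ := by ring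
    have h3 := shadowExp_mono key
    rw [shadowExp_add, shadowExp_mul, h1] at h3
    rw [hμ]
    have := mul_le_mul_of_nonneg_left h2 (show 0 ≤ ε / 80 by positivity)
    linarith
  -- With l = 1/T the statistics satisfy |l f| ≤ 1, and lτ - 10l² = ε²/640. Bias ε/8 plus deviation
  -- ε/4 stays below the distance ε/2 from the cut-off to either end of the window.
  have h := Protocol.le_prob_accumulate hρ {S | (∀ p, η ≤ fidelity ρ (v p) → v p ∈ S) ∧
        ∀ w ∈ S, ∃ p, w = v p ∧ η - ε ≤ fidelity ρ (v p)} (shadowMeasurement n d) f K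
    (q := 1) (l := ε / 80) (v := 10) (τ := ε / 4) N le_rfl (by positivity)
    (fun i p => by
      rw [abs_of_nonneg (mul_nonneg (by positivity) (hf0 i p))]
      calc ε / 80 * f i p ≤ ε / 80 * (80 / ε) :=
            mul_le_mul_of_nonneg_left (min_le_right _ _) (by positivity)
        _ = 1 := by field_simp)
    (fun p => by
      have e := sum_shadowMeasurement ρ
        fun φ => min (Complex.normSq (linForm (v p) φ)) (80 / ε) ^ 2
      refine (le_of_eq e).trans (le_trans (shadowExp_mono fun φ => ?_)
        (shadowExp_fidelity_mul_sq_le hρ (hv p)))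
      refine mul_le_mul_of_nonneg_left ?_ (hρ.fidelity_nonneg φ)
      exact pow_le_pow_left₀ (le_min (Complex.normSq_nonneg _) hT.le) (min_le_left _ _) 2)
    (fun b hb => by
      refine le_of_eq (Protocol.prob_output_of_mem ρ ?_).symm
      have hN0 : (0 : ℝ) ≤ N := Nat.cast_nonneg N
      refine ⟨fun p hp => ⟨p, rfl, ?_⟩, ?_⟩
      · have h1 := (abs_lt.mp (hb p)).1
        have h2 := mul_le_mul_of_nonneg_left (hlow p) hN0
        have h3 := mul_le_mul_of_nonneg_left hp hN0
        nlinarith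
      · rintro w ⟨p, rfl, hp⟩
        refine ⟨p, rfl, ?_⟩
        have h1 := (abs_lt.mp (hb p)).2
        have h2 := mul_le_mul_of_nonneg_left (hup p) hN0
        have hpos : (0 : ℝ) < N := by
          -- For N = 0 the strict deviation bound contradicts acceptance.
          rcases hN0.eq_or_lt with h0 | h0
          · rw [← h0] at h1 hp
            simp at h1 hp
            linarith
          · exact h0
        by_contra hlt
        push Not at hlt
        have h3 := mul_lt_mul_of_pos_left hlt hpos
        nlinarith)
  rw [show N * (ε / 80 * (ε / 4) - (ε / 80) ^ 2 * 10) = N * (ε ^ 2 / 640) by ring] at h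
  linarith

/-- The members of `𝒫` whose fidelity with an unknown state is large can be learned with
`O(log(|𝒫|/δ)/ε²)` copies. -/
theorem exists_protocol_learns {n d : ℕ} (A : Fin n → Finset (EuclideanSpace ℂ (Fin d)))
    (hA : ∀ k, ∀ φ ∈ A k, ‖φ‖ = 1) {η ε δ : ℝ} (hε : 0 < ε) (N : ℕ)
    (hN : 2 * (∏ k, (A k).card : ℕ) * Real.exp (-(N * (ε ^ 2 / 640))) ≤ δ) :
    ∃ T : Protocol n d, T.copies ≤ N ∧ T.Learns A η ε δ := by
  obtain ⟨T, hT, h⟩ := exists_protocol_of_fintype (ι := ∀ k, A k) (η := η)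
    (fun p => productState fun k => (p k : EuclideanSpace ℂ (Fin d)))
    (fun p => by
      have := sum_normSq_eq_norm_sq (WithLp.toLp 2
        (productState fun k => (p k : EuclideanSpace ℂ (Fin d))) :
          EuclideanSpace ℂ (Fin n → Fin d))
      rw [norm_productState fun k => hA k _ (p k).2, one_pow] at this
      exact this) hε N (by simpa using hN)
  refine ⟨T, hT, fun ρ hρ => (h ρ hρ).trans (le_of_eq ?_)⟩
  congr 1
  ext S
  constructor
  · rintro ⟨h1, h2⟩
    refine ⟨?_, fun w hw => ?_⟩
    · rintro w ⟨⟨p, hp, rfl⟩, hw⟩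
      exact h1 (fun k => ⟨p k, hp k⟩) hw
    · obtain ⟨p, rfl, hp⟩ := h2 w hw
      exact ⟨⟨_, fun k => (p k).2, rfl⟩, hp⟩
  · rintro ⟨h1, h2⟩
    refine ⟨fun p hp => h1 ⟨⟨_, fun k => (p k).2, rfl⟩, hp⟩, fun w hw => ?_⟩
    obtain ⟨⟨p, hp, rfl⟩, hw'⟩ := h2 hw
    exact ⟨fun k => ⟨p k, hp k⟩, rfl, hw'⟩

/-! ### Product-basis measurements and marginal fidelities. -/

section Basis

variable {n d : ℕ}

theorem OrthonormalBasis.sum_mul_star {d : ℕ}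
    (b : OrthonormalBasis (Fin d) ℂ (EuclideanSpace ℂ (Fin d))) (y z : Fin d) :
    ∑ j, b j y * star (b j z) = if y = z then 1 else 0 := by
  have h := b.sum_inner_mul_inner (EuclideanSpace.single y 1) (EuclideanSpace.single z 1)
  simpa [EuclideanSpace.inner_single_left, EuclideanSpace.inner_single_right, eq_comm] using h

theorem sum_piFinset_vecMulVec_productState
    (b : Fin n → Fin d → EuclideanSpace ℂ (Fin d))
    (t : Fin n → Finset (Fin d)) (y z : Fin n → Fin d) :
    (∑ x ∈ Fintype.piFinset t, Matrix.vecMulVec (productState fun k => b k (x k))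
        (star (productState fun k => b k (x k)))) y z
      = ∏ k, ∑ j ∈ t k, b k j (y k) * star (b k j (z k)) := by
  rw [Matrix.sum_apply, Finset.prod_univ_sum]
  refine Finset.sum_congr rfl fun x _ => ?_
  simp [Matrix.vecMulVec_apply, productState, Finset.prod_mul_distrib]

theorem prod_ite_eq_one (y z : Fin n → Fin d) :
    (∏ k, if y k = z k then (1 : ℂ) else 0)
      = (1 : Matrix (Fin n → Fin d) (Fin n → Fin d) ℂ) y z := by
  simp [Finset.prod_ite_zero, Matrix.one_apply, funext_iff]

/-- The measurement in a product of orthonormal bases. -/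
noncomputable def localMeasurement
    (b : Fin n → OrthonormalBasis (Fin d) ℂ (EuclideanSpace ℂ (Fin d))) :
    Measurement n d (Fintype.card (Fin n → Fin d)) where
  effect i := Matrix.vecMulVec
    (productState fun k => b k ((Fintype.equivFin (Fin n → Fin d)).symm i k))
    (star (productState fun k => b k ((Fintype.equivFin (Fin n → Fin d)).symm i k)))
  posSemidef i := Matrix.posSemidef_vecMulVec_self_star _
  sum_eq_one := by
    rw [Equiv.sum_comp (Fintype.equivFin (Fin n → Fin d)).symm (fun x : Fin n → Fin d =>
      Matrix.vecMulVec (productState fun k => b k (x k))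
        (star (productState fun k => b k (x k))))]
    ext y z
    rw [← Fintype.piFinset_univ, sum_piFinset_vecMulVec_productState fun k j => b k j]
    simp only [OrthonormalBasis.sum_mul_star]
    exact prod_ite_eq_one y z

theorem isLocal_localMeasurement
    (b : Fin n → OrthonormalBasis (Fin d) ℂ (EuclideanSpace ℂ (Fin d))) :
    (localMeasurement b).IsLocal :=
  ⟨b, (Fintype.equivFin (Fin n → Fin d)).symm, fun _ => rfl⟩

theorem sum_localMeasurement (ρ : Matrix (Fin n → Fin d) (Fin n → Fin d) ℂ)
    (b : Fin n → OrthonormalBasis (Fin d) ℂ (EuclideanSpace ℂ (Fin d)))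
    (g : (Fin n → Fin d) → ℝ) :
    ∑ i, (localMeasurement b).outcomeProb ρ i * g ((Fintype.equivFin (Fin n → Fin d)).symm i)
      = ∑ x, fidelity ρ (productState fun k => b k (x k)) * g x := by
  rw [← Equiv.sum_comp (Fintype.equivFin (Fin n → Fin d)).symm]
  refine Finset.sum_congr rfl fun i _ => ?_
  rw [Measurement.outcomeProb, localMeasurement, trace_vecMulVec_mul]

theorem exists_orthonormalBasis_zero_eq [NeZero d] {v : EuclideanSpace ℂ (Fin d)}
    (hv : ‖v‖ = 1) :
    ∃ b : OrthonormalBasis (Fin d) ℂ (EuclideanSpace ℂ (Fin d)), b 0 = v := by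
  have h : Orthonormal ℂ (({0} : Set (Fin d)).domRestrict fun _ => v) := by
    rw [orthonormal_iff_ite]
    intro i j
    rw [if_pos (Subsingleton.elim i j)]
    rw [Set.domRestrict_apply, Set.domRestrict_apply, inner_self_eq_norm_sq_to_K, hv]
    simp
  obtain ⟨b, hb⟩ := h.exists_orthonormalBasis_extension_of_card_eq (by simp)
  exact ⟨b, hb 0 rfl⟩

/-- The projection onto `|p_k⟩` in the positions `k ∈ K`, tensored with the identity elsewhere. -/
noncomputable def prefixProj (K : Finset (Fin n)) (p : Fin n → EuclideanSpace ℂ (Fin d)) :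
    Matrix (Fin n → Fin d) (Fin n → Fin d) ℂ :=
  fun y z => ∏ k, if k ∈ K then p k (y k) * star (p k (z k)) else if y k = z k then 1 else 0

/-- The fidelity of the reduced state on the positions `K` with the product state `p`. -/
noncomputable def prefixFidelity (ρ : Matrix (Fin n → Fin d) (Fin n → Fin d) ℂ)
    (K : Finset (Fin n)) (p : Fin n → EuclideanSpace ℂ (Fin d)) : ℝ :=
  (prefixProj K p * ρ).trace.re

/-- The strings that vanish on `K`. -/
def zeroOn (d : ℕ) [NeZero d] (K : Finset (Fin n)) : Finset (Fin n → Fin d) :=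
  Fintype.piFinset fun k => if k ∈ K then {0} else Finset.univ

theorem mem_zeroOn [NeZero d] {K : Finset (Fin n)} {x : Fin n → Fin d} :
    x ∈ zeroOn d K ↔ ∀ k ∈ K, x k = 0 := by
  rw [zeroOn, Fintype.mem_piFinset]
  refine forall_congr' fun k => ?_
  split_ifs with h <;> simp [h]

/-- On K only the basis vector with index 0 is kept; elsewhere any orthonormal basis resolves the
identity. So a marginal fidelity is the probability that a local measurement yields 0 throughout K.
-/
theorem prefixFidelity_eq_sum [NeZero d] (ρ : Matrix (Fin n → Fin d) (Fin n → Fin d) ℂ)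
    (K : Finset (Fin n)) (p : Fin n → EuclideanSpace ℂ (Fin d))
    (b : Fin n → OrthonormalBasis (Fin d) ℂ (EuclideanSpace ℂ (Fin d)))
    (hb : ∀ k ∈ K, b k 0 = p k) :
    prefixFidelity ρ K p = ∑ x ∈ zeroOn d K, fidelity ρ (productState fun k => b k (x k)) := by
  have h : prefixProj K p = ∑ x ∈ zeroOn d K,
      Matrix.vecMulVec (productState fun k => b k (x k))
        (star (productState fun k => b k (x k))) := by
    ext y z
    rw [zeroOn, sum_piFinset_vecMulVec_productState fun k j => b k j, prefixProj]
    refine Finset.prod_congr rfl fun k _ => ?_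
    split_ifs with hk h
    · rw [Finset.sum_singleton, hb k hk]
    · rw [OrthonormalBasis.sum_mul_star, if_pos h]
    · rw [OrthonormalBasis.sum_mul_star, if_neg h]
  rw [prefixFidelity, h, Finset.sum_mul, Matrix.trace_sum, Complex.re_sum]
  exact Finset.sum_congr rfl fun x _ => trace_vecMulVec_mul _ _

theorem prefixFidelity_empty {ρ : Matrix (Fin n → Fin d) (Fin n → Fin d) ℂ} (hρ : IsDensity ρ)
    (p : Fin n → EuclideanSpace ℂ (Fin d)) : prefixFidelity ρ ∅ p = 1 := by
  have h : prefixProj ∅ p = (1 : Matrix (Fin n → Fin d) (Fin n → Fin d) ℂ) := by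
    ext y z
    simpa [prefixProj] using prod_ite_eq_one y z
  rw [prefixFidelity, h, one_mul, hρ.2, Complex.one_re]

theorem prefixFidelity_univ (ρ : Matrix (Fin n → Fin d) (Fin n → Fin d) ℂ)
    (p : Fin n → EuclideanSpace ℂ (Fin d)) :
    prefixFidelity ρ Finset.univ p = fidelity ρ (productState p) := by
  have h : prefixProj Finset.univ p
      = Matrix.vecMulVec (productState p) (star (productState p)) := by
    ext y z
    simp [prefixProj, Matrix.vecMulVec_apply, productState, Finset.prod_mul_distrib]
  rw [prefixFidelity, h, trace_vecMulVec_mul]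

theorem prefixFidelity_congr (ρ : Matrix (Fin n → Fin d) (Fin n → Fin d) ℂ)
    {K : Finset (Fin n)} {p q : Fin n → EuclideanSpace ℂ (Fin d)} (h : ∀ k ∈ K, p k = q k) :
    prefixFidelity ρ K p = prefixFidelity ρ K q := by
  have e : prefixProj K p = prefixProj K q := by
    ext y z
    refine Finset.prod_congr rfl fun k _ => ?_
    split_ifs with hk <;> simp_all
  rw [prefixFidelity, e, prefixFidelity]

/-- In a product basis extending p, outcomes vanishing on K' form a smaller event than those
vanishing on K. -/
theorem prefixFidelity_anti [NeZero d] {ρ : Matrix (Fin n → Fin d) (Fin n → Fin d) ℂ}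
    (hρ : IsDensity ρ) {K K' : Finset (Fin n)} (hK : K ⊆ K')
    {p : Fin n → EuclideanSpace ℂ (Fin d)} (hp : ∀ k, ‖p k‖ = 1) :
    prefixFidelity ρ K' p ≤ prefixFidelity ρ K p := by
  choose b hb using fun k => exists_orthonormalBasis_zero_eq (hp k)
  rw [prefixFidelity_eq_sum ρ K' p b fun k _ => hb k,
    prefixFidelity_eq_sum ρ K p b fun k _ => hb k]
  refine Finset.sum_le_sum_of_subset_of_nonneg (fun x hx => ?_)
    fun x _ _ => hρ.fidelity_nonneg _
  rw [mem_zeroOn] at hx ⊢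
  exact fun k hk => hx k (hK hk)

end Basis

/-! ### The number of product states of large fidelity. -/

/-- A Bessel inequality for vectors that need not be orthogonal. -/
theorem sum_norm_inner_sq_le_of_rowSum_le {E κ : Type*} [NormedAddCommGroup E]
    [InnerProductSpace ℂ E] (s : Finset κ) (w : κ → E) {R : ℝ}
    (hR0 : 0 ≤ R) (hR : ∀ i ∈ s, ∑ j ∈ s, ‖inner ℂ (w i) (w j)‖ ≤ R) (v : E) :
    ∑ i ∈ s, ‖inner ℂ v (w i)‖ ^ 2 ≤ R * ‖v‖ ^ 2 := by
  set T := ∑ i ∈ s, ‖inner ℂ v (w i)‖ ^ 2 with hT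
  have hT0 : 0 ≤ T := Finset.sum_nonneg fun _ _ => by positivity
  let c : κ → ℂ := fun i => inner ℂ (w i) v
  have hc : ∀ i, ‖c i‖ = ‖inner ℂ v (w i)‖ := fun i => norm_inner_symm _ _
  -- Here ⟨y, v⟩ = T, while Schur's test on the Gram matrix gives |y|² ≤ RT. Cauchy–Schwarz then
  -- yields T² ≤ RT|v|².
  set y := ∑ i ∈ s, c i • w i with hy
  have h1 : inner ℂ y v = (T : ℂ) := by
    rw [hy, sum_inner, hT, Complex.ofReal_sum]
    refine Finset.sum_congr rfl fun i _ => ?_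
    rw [inner_smul_left, ← hc]
    exact_mod_cast Complex.conj_mul' (c i)
  have h2 : ‖y‖ ^ 2 ≤ R * T := by
    have e : ((‖y‖ ^ 2 : ℝ) : ℂ)
        = ∑ i ∈ s, ∑ j ∈ s, star (c i) * (c j * inner ℂ (w i) (w j)) := by
      have := inner_self_eq_norm_sq_to_K (𝕜 := ℂ) y
      push_cast
      refine this.symm.trans ?_
      rw [hy, sum_inner]
      refine Finset.sum_congr rfl fun i _ => ?_
      rw [inner_smul_left, inner_sum, Finset.mul_sum]
      exact Finset.sum_congr rfl fun j _ => by rw [inner_smul_right]; rfl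
    have e1 : ‖y‖ ^ 2 ≤ ∑ i ∈ s, ∑ j ∈ s, ‖c i‖ * (‖c j‖ * ‖inner ℂ (w i) (w j)‖) := by
      calc ‖y‖ ^ 2 = ‖((‖y‖ ^ 2 : ℝ) : ℂ)‖ := by
            rw [Complex.norm_real, Real.norm_of_nonneg (by positivity)]
        _ ≤ _ := by
          rw [e]
          refine (norm_sum_le _ _).trans (Finset.sum_le_sum fun i _ => ?_)
          refine (norm_sum_le _ _).trans (Finset.sum_le_sum fun j _ => ?_)
          simp
    have e2 : ∀ i ∈ s, ∀ j ∈ s, ‖c i‖ * (‖c j‖ * ‖inner ℂ (w i) (w j)‖)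
        ≤ 1 / 2 * (‖c i‖ ^ 2 * ‖inner ℂ (w i) (w j)‖)
          + 1 / 2 * (‖c j‖ ^ 2 * ‖inner ℂ (w j) (w i)‖) := by
      intro i _ j _
      rw [norm_inner_symm (w j) (w i)]
      have := mul_nonneg (sq_nonneg (‖c i‖ - ‖c j‖)) (norm_nonneg (inner ℂ (w i) (w j)))
      nlinarith
    have e3 : ∑ i ∈ s, ∑ j ∈ s, ‖c i‖ ^ 2 * ‖inner ℂ (w i) (w j)‖ ≤ R * T := by
      rw [hT, Finset.mul_sum]
      refine Finset.sum_le_sum fun i hi => ?_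
      rw [← Finset.mul_sum, mul_comm, hc]
      exact mul_le_mul_of_nonneg_right (hR i hi) (by positivity)
    refine (e1.trans (Finset.sum_le_sum fun i hi => Finset.sum_le_sum (e2 i hi))).trans ?_
    have e4 := e3
    rw [Finset.sum_comm] at e4
    simp only [Finset.sum_add_distrib, ← Finset.mul_sum] at e3 e4 ⊢
    linarith
  have h3 : T ≤ ‖y‖ * ‖v‖ := by
    have := norm_inner_le_norm (𝕜 := ℂ) y v
    rwa [h1, Complex.norm_real, Real.norm_of_nonneg hT0] at this
  rcases hT0.eq_or_lt with h0 | h0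
  · rw [← h0]
    positivity
  · have h4 : T * T ≤ (R * ‖v‖ ^ 2) * T := by
      calc T * T ≤ (‖y‖ * ‖v‖) * (‖y‖ * ‖v‖) := mul_self_le_mul_self hT0 h3
        _ = ‖y‖ ^ 2 * ‖v‖ ^ 2 := by ring
        _ ≤ (R * T) * ‖v‖ ^ 2 := mul_le_mul_of_nonneg_right h2 (by positivity)
        _ = _ := by ring
    exact le_of_mul_le_mul_right h4 h0

section Size

variable {n d : ℕ}

/-- All members are completed off K by the same computational basis. Completions by different
strings are orthogonal; those by the same string have the overlap of p and q, which agree off K and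
so have factors 1 there. The Gram row sums thus remain at most R, and the Bessel inequality applies
to each row of a square root of ρ. -/
theorem sum_prefixFidelity_le [NeZero d] {ρ : Matrix (Fin n → Fin d) (Fin n → Fin d) ℂ}
    (hρ : IsDensity ρ) {K : Finset (Fin n)} {c : Fin n → EuclideanSpace ℂ (Fin d)}
    {G : Finset (Fin n → EuclideanSpace ℂ (Fin d))} (hG : ∀ p ∈ G, ∀ k, ‖p k‖ = 1)
    (hc : ∀ p ∈ G, ∀ k ∉ K, p k = c k) {R : ℝ} (hR0 : 0 ≤ R)
    (hR : ∀ p ∈ G, ∑ q ∈ G, ∏ k, ‖inner ℂ (p k) (q k)‖ ≤ R) :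
    ∑ p ∈ G, prefixFidelity ρ K p ≤ R := by
  classical
  have hex : ∀ (p : Fin n → EuclideanSpace ℂ (Fin d)) (k : Fin n),
      ∃ b : OrthonormalBasis (Fin d) ℂ (EuclideanSpace ℂ (Fin d)),
        (k ∈ K → p ∈ G → b 0 = p k) ∧ (k ∉ K → b = EuclideanSpace.basisFun (Fin d) ℂ) := by
    intro p k
    by_cases h : k ∈ K ∧ p ∈ G
    · obtain ⟨b, hb⟩ := exists_orthonormalBasis_zero_eq (hG p h.2 k)
      exact ⟨b, fun _ _ => hb, fun h' => absurd h.1 h'⟩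
    · exact ⟨_, fun h1 h2 => absurd ⟨h1, h2⟩ h, fun _ => rfl⟩
  choose b hb hb' using hex
  let w : (Fin n → EuclideanSpace ℂ (Fin d)) × (Fin n → Fin d)
      → EuclideanSpace ℂ (Fin n → Fin d) :=
    fun q => WithLp.toLp 2 (productState fun k => b q.1 k (q.2 k))
  obtain ⟨r, hr, hr1⟩ := hρ.exists_rows
  have hw : ∀ p ∈ G, ∀ q ∈ G, ∀ x ∈ zeroOn d K, ∀ y ∈ zeroOn d K,
      ‖inner ℂ (w (p, x)) (w (q, y))‖ = if x = y then ∏ k, ‖inner ℂ (p k) (q k)‖ else 0 := by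
    intro p hp q hq x hx y hy
    rw [mem_zeroOn] at hx hy
    simp only [w, inner_productState, norm_prod]
    split_ifs with hxy
    · refine Finset.prod_congr rfl fun k _ => ?_
      by_cases hk : k ∈ K
      · rw [hx k hk, hy k hk, hb p k hk hp, hb q k hk hq]
      · rw [hb' p k hk, hb' q k hk, hxy, hc p hp k hk, ← hc q hq k hk]
        simp [hG q hq k]
    · obtain ⟨k, hk⟩ := Function.ne_iff.mp hxy
      refine Finset.prod_eq_zero (Finset.mem_univ k) ?_
      have hkK : k ∉ K := fun h => hk ((hx k h).trans (hy k h).symm)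
      rw [hb' p k hkK, hb' q k hkK,
        orthonormal_iff_ite.mp (EuclideanSpace.basisFun (Fin d) ℂ).orthonormal, if_neg hk, norm_zero]
  have hrow : ∀ i ∈ G ×ˢ zeroOn d K, ∑ j ∈ G ×ˢ zeroOn d K, ‖inner ℂ (w i) (w j)‖ ≤ R := by
    rintro ⟨p, x⟩ hi
    obtain ⟨hp, hx⟩ := Finset.mem_product.mp hi
    rw [Finset.sum_product]
    refine le_trans (le_of_eq (Finset.sum_congr rfl fun q hq => ?_)) (hR p hp)
    rw [Finset.sum_congr rfl fun y hy => hw p hp q hq x hx y hy, Finset.sum_ite_eq, if_pos hx]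
  have h1 : ∑ p ∈ G, prefixFidelity ρ K p
      = ∑ s, ∑ i ∈ G ×ˢ zeroOn d K, ‖inner ℂ (r s) (w i)‖ ^ 2 := by
    rw [Finset.sum_comm, Finset.sum_product]
    refine Finset.sum_congr rfl fun p hp => ?_
    rw [prefixFidelity_eq_sum ρ K p (b p) fun k hk => hb p k hk hp]
    exact Finset.sum_congr rfl fun x _ => hr _
  rw [h1]
  refine (Finset.sum_le_sum fun s _ => sum_norm_inner_sq_le_of_rowSum_le _ w hR0 hrow (r s)).trans ?_
  rw [← Finset.mul_sum, hr1, mul_one]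

-- Weight each q by (ns)^(-j), with j its distance from p. The total weight factorizes and is at
-- most (1 + 1/n)^n ≤ e, while each point of the ball weighs at least (ns)^(-m).
open Classical in
theorem card_hammingBall_le {E : Type*} {A : Fin n → Finset E} {s : ℕ}
    (hs : ∀ k, (A k).card ≤ s) (hn : 0 < n) (hs0 : 0 < s) (p : Fin n → E) (m : ℕ) :
    (((Fintype.piFinset A).filter fun q => (Finset.univ.filter fun k => p k ≠ q k).card ≤ m).card
      : ℝ) ≤ Real.exp 1 * (n * s : ℝ) ^ m := by
  have hn' : (1 : ℝ) ≤ n := by exact_mod_cast hn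
  have hs' : (1 : ℝ) ≤ s := by exact_mod_cast hs0
  have hx : (1 : ℝ) ≤ n * s := by nlinarith
  set x : ℝ := n * s with hxdef
  have hx0 : 0 < x := by linarith
  have h1 : ∀ q ∈ (Fintype.piFinset A).filter fun q =>
      (Finset.univ.filter fun k => p k ≠ q k).card ≤ m,
      (1 : ℝ) ≤ x ^ m * ∏ k, if p k ≠ q k then 1 / x else 1 := by
    intro q hq
    rw [Finset.prod_ite, Finset.prod_const, Finset.prod_const_one, mul_one, one_div, inv_pow,
      ← div_eq_mul_inv, one_le_div (by positivity)]
    exact pow_le_pow_right₀ hx (Finset.mem_filter.mp hq).2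
  have h2 : ∑ q ∈ Fintype.piFinset A, ∏ k, (if p k ≠ q k then 1 / x else 1) ≤ Real.exp 1 := by
    rw [← Finset.prod_univ_sum A fun k a => if p k ≠ a then 1 / x else 1]
    have h3 : ∀ k, ∑ a ∈ A k, (if p k ≠ a then 1 / x else 1) ≤ 1 / n + 1 := by
      intro k
      have h4 : ∀ a ∈ A k, (if p k ≠ a then 1 / x else 1) ≤ 1 / x + if p k = a then 1 else 0 := by
        intro a _
        split_ifs <;> simp_all
      refine (Finset.sum_le_sum h4).trans ?_
      rw [Finset.sum_add_distrib, Finset.sum_const, nsmul_eq_mul, Finset.sum_ite_eq]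
      have h5 : (A k).card * (1 / x) ≤ 1 / n := by
        have : ((A k).card : ℝ) ≤ s := by exact_mod_cast hs k
        calc (A k).card * (1 / x) ≤ s * (1 / x) := by gcongr
          _ = 1 / n := by rw [hxdef]; field_simp
      have h6 : (if p k ∈ A k then (1 : ℝ) else 0) ≤ 1 := by split_ifs <;> norm_num
      linarith
    calc ∏ k, ∑ a ∈ A k, (if p k ≠ a then 1 / x else 1) ≤ ∏ _k : Fin n, (1 / (n : ℝ) + 1) :=
          Finset.prod_le_prod (fun k _ => Finset.sum_nonneg fun a _ => by
            split_ifs <;> positivity) fun k _ => h3 k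
      _ = (1 / (n : ℝ) + 1) ^ n := by simp
      _ ≤ Real.exp (1 / n) ^ n :=
          pow_le_pow_left₀ (by positivity) (Real.add_one_le_exp _) n
      _ = Real.exp 1 := by rw [← Real.exp_nat_mul]; congr 1; field_simp
  calc _ = ∑ q ∈ (Fintype.piFinset A).filter fun q =>
        (Finset.univ.filter fun k => p k ≠ q k).card ≤ m, (1 : ℝ) := by simp
    _ ≤ ∑ q ∈ (Fintype.piFinset A).filter fun q =>
        (Finset.univ.filter fun k => p k ≠ q k).card ≤ m,
          x ^ m * ∏ k, if p k ≠ q k then 1 / x else 1 := Finset.sum_le_sum h1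
    _ ≤ ∑ q ∈ Fintype.piFinset A, x ^ m * ∏ k, if p k ≠ q k then 1 / x else 1 :=
        Finset.sum_le_sum_of_subset_of_nonneg (Finset.filter_subset _ _) fun q _ _ =>
          mul_nonneg (by positivity) (Finset.prod_nonneg fun k _ => by
            split_ifs <;> positivity)
    _ ≤ x ^ m * Real.exp 1 := by
        rw [← Finset.mul_sum]; exact mul_le_mul_of_nonneg_left h2 (by positivity)
    _ = _ := mul_comm _ _

-- Points within distance m contribute at most 1 each, the others at most γ^(m+1).
open Classical in
theorem sum_prod_norm_inner_le {A : Fin n → Finset (EuclideanSpace ℂ (Fin d))}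
    (hA : ∀ k, ∀ φ ∈ A k, ‖φ‖ = 1) {γ : ℝ} (hγ0 : 0 ≤ γ) (hγ1 : γ ≤ 1)
    (hov : ∀ k, ∀ φ ∈ A k, ∀ φ' ∈ A k, φ ≠ φ' → ‖inner ℂ φ φ'‖ ≤ γ)
    {G : Finset (Fin n → EuclideanSpace ℂ (Fin d))} (hG : ∀ p ∈ G, ∀ k, p k ∈ A k)
    {p : Fin n → EuclideanSpace ℂ (Fin d)} (hp : ∀ k, p k ∈ A k) (m : ℕ) :
    ∑ q ∈ G, ∏ k, ‖inner ℂ (p k) (q k)‖ ≤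
      (((Fintype.piFinset A).filter fun q =>
        (Finset.univ.filter fun k => p k ≠ q k).card ≤ m).card : ℝ) + G.card * γ ^ (m + 1) := by
  have h1 : ∀ q ∈ G, ∏ k, ‖inner ℂ (p k) (q k)‖ ≤
      (if (Finset.univ.filter fun k => p k ≠ q k).card ≤ m then 1 else 0) + γ ^ (m + 1) := by
    intro q hq
    have h2 : ∏ k, ‖inner ℂ (p k) (q k)‖ ≤ γ ^ (Finset.univ.filter fun k => p k ≠ q k).card := by
      calc ∏ k, ‖inner ℂ (p k) (q k)‖ ≤ ∏ k, if p k ≠ q k then γ else 1 := by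
            refine Finset.prod_le_prod (fun _ _ => norm_nonneg _) fun k _ => ?_
            split_ifs with h
            · exact hov k _ (hp k) _ (hG q hq k) h
            · refine (norm_inner_le_norm _ _).trans ?_
              rw [hA k _ (hp k), hA k _ (hG q hq k), one_mul]
        _ = _ := by rw [Finset.prod_ite, Finset.prod_const, Finset.prod_const_one, mul_one]
    refine h2.trans ?_
    split_ifs with h
    · have := pow_le_one₀ hγ0 hγ1 (n := (Finset.univ.filter fun k => p k ≠ q k).card)
      have := pow_nonneg hγ0 (m + 1)
      linarith
    · rw [zero_add]
      exact pow_le_pow_of_le_one hγ0 hγ1 (by omega)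
  refine (Finset.sum_le_sum h1).trans ?_
  rw [Finset.sum_add_distrib, Finset.sum_const, nsmul_eq_mul, Finset.sum_boole]
  gcongr
  intro q hq
  exact Fintype.mem_piFinset.mpr (hG q hq)

/-- In a family of product states that are pairwise far from parallel, few have a large fidelity
with (a marginal of) a given state. -/
theorem card_le_of_le_prefixFidelity [NeZero d] {A : Fin n → Finset (EuclideanSpace ℂ (Fin d))}
    (hA : ∀ k, ∀ φ ∈ A k, ‖φ‖ = 1) {s : ℕ} (hs : ∀ k, (A k).card ≤ s) (hn : 0 < n) (hs0 : 0 < s)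
    {γ : ℝ} (hγ0 : 1 / Real.exp 1 ≤ γ) (hγ1 : γ < 1)
    (hov : ∀ k, ∀ φ ∈ A k, ∀ φ' ∈ A k, φ ≠ φ' → ‖inner ℂ φ φ'‖ ≤ γ)
    {η : ℝ} (hη0 : 0 < η) (hη1 : η < 1)
    {ρ : Matrix (Fin n → Fin d) (Fin n → Fin d) ℂ} (hρ : IsDensity ρ)
    {K : Finset (Fin n)} {c : Fin n → EuclideanSpace ℂ (Fin d)}
    {G : Finset (Fin n → EuclideanSpace ℂ (Fin d))} (hG : ∀ p ∈ G, ∀ k, p k ∈ A k)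
    (hc : ∀ p ∈ G, ∀ k ∉ K, p k = c k) (hGη : ∀ p ∈ G, η ≤ prefixFidelity ρ K p) :
    (G.card : ℝ) ≤ Real.exp (2 * (Real.log (2 / η) / Real.log (1 / γ)))
      * (n * s : ℝ) ^ (Real.log (2 / η) / Real.log (1 / γ)) := by
  classical
  have hγpos : 0 < γ := lt_of_lt_of_le (by positivity) hγ0
  have hl0 : 0 < Real.log (1 / γ) := Real.log_pos (by rw [lt_div_iff₀ hγpos]; linarith)
  have hl1 : Real.log (1 / γ) ≤ 1 := by
    rw [Real.log_le_iff_le_exp (by positivity)]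
    rw [div_le_iff₀ (by positivity)] at hγ0 ⊢
    linarith
  have h2η : 0 < Real.log (2 / η) := Real.log_pos (by rw [lt_div_iff₀ hη0]; linarith)
  set l := Real.log (1 / γ) with hl
  set L := Real.log (2 / η) / l with hL
  have hL0 : 0 < L := div_pos h2η hl0
  have hlL : l * L = Real.log (2 / η) := by rw [hL]; field_simp
  have hn' : (1 : ℝ) ≤ n := by exact_mod_cast hn
  have hs' : (1 : ℝ) ≤ s := by exact_mod_cast hs0
  have hx : (1 : ℝ) ≤ n * s := by nlinarith
  set x : ℝ := n * s with hxdef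
  have h2η_le : 2 / η ≤ Real.exp L := by
    rw [← Real.log_le_iff_le_exp (by positivity), ← hlL]
    nlinarith
  -- Radius m = ⌈L⌉ - 1: it is below L, so (ns)^m ≤ (ns)^L, and γ^(m+1) ≤ γ^L = η/2.
  obtain ⟨m, hm⟩ : ∃ m, ⌈L⌉₊ = m + 1 :=
    Nat.exists_eq_succ_of_ne_zero (Nat.ceil_pos.mpr hL0).ne'
  have hmL : (m : ℝ) < L := by
    have := Nat.ceil_lt_add_one hL0.le
    rw [hm] at this
    push_cast at this
    linarith
  have hγm : γ ^ (m + 1) ≤ η / 2 := by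
    have e : γ = Real.exp (-l) := by
      rw [hl, one_div, Real.log_inv, neg_neg, Real.exp_log hγpos]
    have e2 : η / 2 = Real.exp (-(l * L)) := by
      rw [hlL, Real.exp_neg, Real.exp_log (by positivity), inv_div]
    rw [e, e2, ← Real.exp_nat_mul, Real.exp_le_exp]
    have : L ≤ ((m + 1 : ℕ) : ℝ) := by rw [← hm]; exact Nat.le_ceil L
    nlinarith
  -- The factor e of the general ball bound fits into exp(2L) only when L ≥ 1. For m = 0, where L
  -- may be smaller, the ball is a single point and B = 1 serves.
  obtain ⟨B, hB0, hB, hball⟩ : ∃ B : ℝ, 0 ≤ B ∧ Real.exp L * B ≤ Real.exp (2 * L) * x ^ L ∧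
      ∀ p : Fin n → EuclideanSpace ℂ (Fin d), (((Fintype.piFinset A).filter fun q =>
        (Finset.univ.filter fun k => p k ≠ q k).card ≤ m).card : ℝ) ≤ B := by
    rcases Nat.eq_zero_or_pos m with rfl | hm0
    · refine ⟨1, zero_le_one, ?_, fun p => ?_⟩
      · have h1 : Real.exp L ≤ Real.exp (2 * L) := Real.exp_le_exp.mpr (by linarith)
        have h2 : 1 ≤ x ^ L := Real.one_le_rpow hx hL0.le
        exact mul_le_mul h1 h2 zero_le_one (Real.exp_pos _).le
      · have : (Fintype.piFinset A).filter (fun q =>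
            (Finset.univ.filter fun k => p k ≠ q k).card ≤ 0) ⊆ {p} := by
          intro q hq
          have h := (Finset.mem_filter.mp hq).2
          rw [Nat.le_zero, Finset.card_eq_zero, Finset.filter_eq_empty_iff] at h
          rw [Finset.mem_singleton]
          funext k
          exact (not_not.mp (h (Finset.mem_univ k))).symm
        exact_mod_cast (Finset.card_le_card this).trans (by simp)
    · refine ⟨Real.exp 1 * x ^ m, by positivity, ?_, fun p => ?_⟩
      swap
      · convert card_hammingBall_le hs hn hs0 p m
      have h1 : (1 : ℝ) ≤ m := by exact_mod_cast hm0
      rw [← mul_assoc, ← Real.exp_add]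
      have h2 : x ^ m ≤ x ^ L := by
        rw [← Real.rpow_natCast]
        exact Real.rpow_le_rpow_of_exponent_le hx hmL.le
      exact mul_le_mul (Real.exp_le_exp.mpr (by linarith)) h2 (by positivity) (by positivity)
  have hrow : ∑ p ∈ G, prefixFidelity ρ K p ≤ B + G.card * (η / 2) := by
    refine sum_prefixFidelity_le hρ (fun p hp k => hA k _ (hG p hp k)) hc (by positivity)
      fun p hp => ?_
    refine (sum_prod_norm_inner_le hA hγpos.le hγ1.le hov hG (hG p hp) m).trans ?_
    gcongr
    exact hball p
  have hsum : G.card * η ≤ ∑ p ∈ G, prefixFidelity ρ K p := by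
    rw [← nsmul_eq_mul]
    exact Finset.card_nsmul_le_sum _ _ _ hGη
  have h3 : (G.card : ℝ) ≤ 2 / η * B := by
    rw [div_mul_eq_mul_div, le_div_iff₀ hη0]
    linarith
  calc (G.card : ℝ) ≤ 2 / η * B := h3
    _ ≤ Real.exp L * B := mul_le_mul_of_nonneg_right h2η_le hB0
    _ ≤ _ := hB

end Size

/-! ### Search through prefixes with local measurements. -/

section Tree

variable {n d : ℕ}

open Classical in
/-- Test one candidate after the other for a large fidelity with a marginal of the unknown state,
and go on with the set of those that pass. -/
theorem exists_protocol_filter [NeZero d] (K : Finset (Fin n)) {η ε : ℝ} (hε : 0 < ε)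
    (hε1 : ε ≤ 1) (N : ℕ) (cont : Finset (Fin n → EuclideanSpace ℂ (Fin d)) → Protocol n d)
    (hloc : ∀ S, (cont S).IsLocal) {c : ℕ} (hcop : ∀ S, (cont S).copies ≤ c)
    (l : List (Fin n → EuclideanSpace ℂ (Fin d))) (hl : ∀ p ∈ l, ∀ k, ‖p k‖ = 1)
    (acc : Finset (Fin n → EuclideanSpace ℂ (Fin d))) :
    ∃ T : Protocol n d, T.IsLocal ∧ T.copies ≤ l.length * N + c ∧
      ∀ ρ, IsDensity ρ → ∀ good, ∀ q ≤ (1 : ℝ),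
        (∀ S : Finset (Fin n → EuclideanSpace ℂ (Fin d)),
          (∀ p ∈ l, η ≤ prefixFidelity ρ K p → p ∈ S) → (∀ p ∈ acc, p ∈ S) →
          (∀ p ∈ S, p ∈ acc ∨ (p ∈ l ∧ η - ε ≤ prefixFidelity ρ K p)) →
          q ≤ (cont S).prob ρ good) →
        q - l.length * (2 * Real.exp (-(N * (ε ^ 2 / 16)))) ≤ T.prob ρ good := by
  induction l generalizing acc with
  | nil =>
    refine ⟨cont acc, hloc acc, by simpa using hcop acc, fun ρ hρ good q _ h => ?_⟩
    simpa using h acc (by simp) (fun p hp => hp) (fun p hp => Or.inl hp)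
  | cons p l ih =>
    obtain ⟨T₁, hT₁, hc₁, h₁⟩ := ih (fun q hq => hl q (List.mem_cons_of_mem _ hq)) (insert p acc)
    obtain ⟨T₂, hT₂, hc₂, h₂⟩ := ih (fun q hq => hl q (List.mem_cons_of_mem _ hq)) acc
    choose b hb using fun k => exists_orthonormalBasis_zero_eq (hl p List.mem_cons_self k)
    let g : (Fin n → Fin d) → ℝ := fun x => if x ∈ zeroOn d K then 1 else 0
    let f : Fin (Fintype.card (Fin n → Fin d)) → Unit → ℝ := fun i _ =>
      g ((Fintype.equivFin (Fin n → Fin d)).symm i)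
    let next : (Unit → ℝ) → Protocol n d := fun a =>
      if N * (η - ε / 2) ≤ a () then T₁ else T₂
    have hg : ∀ x, g x = 0 ∨ g x = 1 := fun x => by
      by_cases h : x ∈ zeroOn d K <;> simp [g, h]
    refine ⟨Protocol.accumulate (localMeasurement b) f next N 0, ?_, ?_, ?_⟩
    · refine Protocol.isLocal_accumulate (isLocal_localMeasurement b) f next (fun a => ?_) N 0
      by_cases h : N * (η - ε / 2) ≤ a () <;> simp only [next, h, if_true, if_false, hT₁, hT₂]
    · refine (Protocol.copies_accumulate_le (c := l.length * N + c) _ f next (fun a => ?_) N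
        0).trans (le_of_eq ?_)
      · by_cases h : N * (η - ε / 2) ≤ a () <;> simp only [next, h, if_true, if_false, hc₁, hc₂]
      · rw [List.length_cons]; ring
    · intro ρ hρ good q hq H
      set β := 2 * Real.exp (-(N * (ε ^ 2 / 16))) with hβ
      have hβ0 : 0 ≤ β := by positivity
      have hμ : ∑ i, (localMeasurement b).outcomeProb ρ i * f i () = prefixFidelity ρ K p := by
        rw [prefixFidelity_eq_sum ρ K p b fun k _ => hb k, sum_localMeasurement ρ b g]
        simp [g, Finset.sum_ite_mem]
      have hle : (q - l.length * β) ≤ 1 := by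
        have : 0 ≤ l.length * β := by positivity
        linarith
      -- The cut-off η - ε/2 is the midpoint of the window, so a deviation below ε/2 decides
      -- correctly. With second moment at most 1 the best l is ε/4, and lτ - l² = ε²/16.
      have key := Protocol.le_prob_accumulate hρ good (localMeasurement b) f next
        (q := q - l.length * β) (l := ε / 4) (v := 1) (τ := ε / 2) N hle (by positivity)
        (fun i _ => by
          rcases hg ((Fintype.equivFin (Fin n → Fin d)).symm i) with h | h <;>
            simp only [f, h, mul_zero, abs_zero, zero_le_one, mul_one]
          rw [abs_of_pos (by positivity)]
          linarith)
        (fun _ => by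
          rw [← (localMeasurement b).sum_outcomeProb hρ]
          refine Finset.sum_le_sum fun i _ => ?_
          have := (localMeasurement b).outcomeProb_nonneg hρ i
          rcases hg ((Fintype.equivFin (Fin n → Fin d)).symm i) with h | h <;>
            simp only [f, h] <;> linarith)
        (fun a ha => by
          have ha' := abs_lt.mp (ha ())
          rw [hμ] at ha'
          have hN0 : (0 : ℝ) ≤ N := Nat.cast_nonneg N
          by_cases h : N * (η - ε / 2) ≤ a ()
          · simp only [next, h, if_true]
            refine h₁ ρ hρ good q hq fun S hS1 hS2 hS3 => H S ?_ ?_ ?_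
            · intro r hr hrη
              rcases List.mem_cons.mp hr with rfl | hr
              · exact hS2 _ (Finset.mem_insert_self _ _)
              · exact hS1 r hr hrη
            · exact fun r hr => hS2 r (Finset.mem_insert_of_mem hr)
            · intro r hr
              rcases hS3 r hr with h' | h'
              · rcases Finset.mem_insert.mp h' with rfl | h'
                · refine Or.inr ⟨List.mem_cons_self, ?_⟩
                  by_contra hlt
                  push Not at hlt
                  nlinarith
                · exact Or.inl h'
              · exact Or.inr ⟨List.mem_cons_of_mem _ h'.1, h'.2⟩
          · simp only [next, h, if_false]
            refine h₂ ρ hρ good q hq fun S hS1 hS2 hS3 => H S ?_ hS2 ?_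
            · intro r hr hrη
              rcases List.mem_cons.mp hr with rfl | hr
              · exfalso
                push Not at h
                nlinarith
              · exact hS1 r hr hrη
            · intro r hr
              rcases hS3 r hr with h' | h'
              · exact Or.inl h'
              · exact Or.inr ⟨List.mem_cons_of_mem _ h'.1, h'.2⟩)
      refine le_trans (le_of_eq ?_) key
      rw [show N * (ε / 4 * (ε / 2) - (ε / 4) ^ 2 * 1) = N * (ε ^ 2 / 16) by ring, List.length_cons,
        hβ]
      push_cast
      simp
      ring

/-- `S` is a set of product states, equal to the reference state `c` off `K`, that contains those
with fidelity at least `η` on `K`, and only ones with fidelity at least `η - ε`. -/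
def IsCandidateSet (A : Fin n → Finset (EuclideanSpace ℂ (Fin d)))
    (c : Fin n → EuclideanSpace ℂ (Fin d)) (η ε : ℝ)
    (ρ : Matrix (Fin n → Fin d) (Fin n → Fin d) ℂ) (K : Finset (Fin n))
    (S : Finset (Fin n → EuclideanSpace ℂ (Fin d))) : Prop :=
  (∀ p, (∀ k, p k ∈ A k) → (∀ k ∉ K, p k = c k) → η ≤ prefixFidelity ρ K p → p ∈ S) ∧
    ∀ p ∈ S, (∀ k, p k ∈ A k) ∧ (∀ k ∉ K, p k = c k) ∧ η - ε ≤ prefixFidelity ρ K p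

-- No good extension is lost: resetting position k of a good p to the reference state does not lower
-- the marginal fidelity, since K is smaller than `insert k K`. The reset tuple thus lies in `S`,
-- and p is one of its extensions.
open Classical in
theorem IsCandidateSet.insert [NeZero d] {A : Fin n → Finset (EuclideanSpace ℂ (Fin d))}
    (hA : ∀ k, ∀ φ ∈ A k, ‖φ‖ = 1)
    {c : Fin n → EuclideanSpace ℂ (Fin d)} (hc : ∀ k, c k ∈ A k) {η ε : ℝ}
    {ρ : Matrix (Fin n → Fin d) (Fin n → Fin d) ℂ} (hρ : IsDensity ρ) {K : Finset (Fin n)}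
    {S S' : Finset (Fin n → EuclideanSpace ℂ (Fin d))} (hS : IsCandidateSet A c η ε ρ K S)
    {k : Fin n} (hk : k ∉ K)
    (h1 : ∀ p ∈ (S ×ˢ A k).image (fun q => Function.update q.1 k q.2),
      η ≤ prefixFidelity ρ (insert k K) p → p ∈ S')
    (h2 : ∀ p ∈ S', p ∈ (S ×ˢ A k).image (fun q => Function.update q.1 k q.2) ∧
      η - ε ≤ prefixFidelity ρ (insert k K) p) :
    IsCandidateSet A c η ε ρ (insert k K) S' := by
  refine ⟨fun p hpA hpc hpη => h1 p ?_ hpη, fun p hp => ?_⟩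
  · have h3 : Function.update p k (c k) ∈ S := by
      refine hS.1 _ (fun j => ?_) (fun j hj => ?_) ?_
      · rcases eq_or_ne j k with rfl | h
        · simpa using hc j
        · simpa [h] using hpA j
      · rcases eq_or_ne j k with rfl | h
        · simp
        · simpa [h] using hpc j (by simp [h, hj])
      · rw [prefixFidelity_congr ρ (q := p) fun j hj => by
          have : j ≠ k := fun h => hk (h ▸ hj)
          simp [this]]
        exact hpη.trans (prefixFidelity_anti hρ (Finset.subset_insert k K)
          fun j => hA j _ (hpA j))
    refine Finset.mem_image.mpr ⟨(Function.update p k (c k), p k),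
      Finset.mem_product.mpr ⟨h3, hpA k⟩, ?_⟩
    simp
  · obtain ⟨hp1, hp2⟩ := h2 p hp
    obtain ⟨⟨q, a⟩, hq, rfl⟩ := Finset.mem_image.mp hp1
    obtain ⟨hqS, ha⟩ := Finset.mem_product.mp hq
    obtain ⟨hqA, hqc, -⟩ := hS.2 q hqS
    refine ⟨fun j => ?_, fun j hj => ?_, hp2⟩
    · rcases eq_or_ne j k with rfl | h
      · simpa using ha
      · simpa [h] using hqA j
    · rw [Finset.mem_insert, not_or] at hj
      simpa [hj.1] using hqc j hj.2

/-- `K` holds the positions already treated and `ks` those to come. A level tests at most s·B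
extensions and has a continuation ready for every set that may survive; the failure probabilities
add up. -/
theorem exists_protocol_levels [NeZero d] {A : Fin n → Finset (EuclideanSpace ℂ (Fin d))}
    (hA : ∀ k, ∀ φ ∈ A k, ‖φ‖ = 1) {s : ℕ} (hs : ∀ k, (A k).card ≤ s)
    {c : Fin n → EuclideanSpace ℂ (Fin d)} (hc : ∀ k, c k ∈ A k) {η ε : ℝ} (hε : 0 < ε)
    (hε1 : ε ≤ 1) (N B : ℕ)
    (hB : ∀ ρ, IsDensity ρ → ∀ K S, IsCandidateSet A c η ε ρ K S → S.card ≤ B)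
    (ks : List (Fin n)) (hks : ks.Nodup) (K : Finset (Fin n)) (hK : ∀ j, j ∈ K ↔ j ∉ ks)
    (S : Finset (Fin n → EuclideanSpace ℂ (Fin d))) :
    ∃ T : Protocol n d, T.IsLocal ∧ T.copies ≤ ks.length * (s * B * N) ∧
      ∀ ρ, IsDensity ρ → IsCandidateSet A c η ε ρ K S →
        1 - ks.length * (s * B * (2 * Real.exp (-(N * (ε ^ 2 / 16))))) ≤
          T.prob ρ {S | goodStates A ρ η ⊆ S ∧ S ⊆ goodStates A ρ (η - ε)} := by
  classical
  induction ks generalizing K S with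
  | nil =>
    have hKu : K = Finset.univ := by ext j; simp [hK]
    subst hKu
    refine ⟨.output {v | ∃ p ∈ S, v = productState p}, trivial, Nat.zero_le _,
      fun ρ hρ hS => ?_⟩
    rw [Protocol.prob_output_of_mem]
    · simp
    · constructor
      · rintro v ⟨⟨p, hp, rfl⟩, hv⟩
        exact ⟨p, hS.1 p hp (by simp) (by rwa [prefixFidelity_univ]), rfl⟩
      · rintro v ⟨p, hp, rfl⟩
        obtain ⟨h1, -, h3⟩ := hS.2 p hp
        exact ⟨⟨p, h1, rfl⟩, by rwa [prefixFidelity_univ] at h3⟩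
  | cons k ks ih =>
    -- An `S` that violates these conditions is not a candidate set for any state, so nothing is
    -- promised for it. Stopping there keeps the worst-case number of copies bounded on every
    -- branch.
    by_cases hS : (∀ p ∈ S, ∀ j, p j ∈ A j) ∧ S.card ≤ B
    swap
    · exact ⟨.output ∅, trivial, Nat.zero_le _, fun ρ hρ h =>
        absurd ⟨fun p hp => (h.2 p hp).1, hB ρ hρ K S h⟩ hS⟩
    have hkK : k ∉ K := fun h => (hK k).mp h List.mem_cons_self
    have hnd := List.nodup_cons.mp hks
    have hK' : ∀ j, j ∈ insert k K ↔ j ∉ ks := by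
      intro j
      rw [Finset.mem_insert, hK, List.mem_cons, not_or]
      by_cases h : j = k
      · subst h; simp [hnd.1]
      · simp [h]
    choose cont hloc hcop hprob using fun S' => ih hnd.2 (insert k K) hK' S'
    obtain ⟨T, hT, hTc, h⟩ := exists_protocol_filter (insert k K) (η := η) hε hε1 N cont hloc hcop
      ((S ×ˢ A k).image (fun q => Function.update q.1 k q.2)).toList
      (fun p hp j => by
        obtain ⟨⟨q, a⟩, hq, rfl⟩ := Finset.mem_image.mp (Finset.mem_toList.mp hp)
        obtain ⟨hqS, ha⟩ := Finset.mem_product.mp hq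
        rcases eq_or_ne j k with rfl | h
        · simpa using hA j a ha
        · simpa [h] using hA j _ (hS.1 q hqS j)) ∅
    have hlen : ((S ×ˢ A k).image (fun q => Function.update q.1 k q.2)).toList.length ≤ s * B := by
      rw [Finset.length_toList]
      refine Finset.card_image_le.trans ?_
      rw [Finset.card_product, mul_comm]
      exact Nat.mul_le_mul (hs k) hS.2
    refine ⟨T, hT, hTc.trans ?_, fun ρ hρ hcand => ?_⟩
    · rw [List.length_cons, Nat.succ_mul, add_comm]
      exact Nat.add_le_add_left (Nat.mul_le_mul_right N hlen) _
    · set β := 2 * Real.exp (-(N * (ε ^ 2 / 16))) with hβ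
      have hβ0 : 0 ≤ β := by positivity
      have h3 := h ρ hρ {S | goodStates A ρ η ⊆ S ∧ S ⊆ goodStates A ρ (η - ε)}
        (1 - ks.length * (s * B * β)) (by
          have : 0 ≤ ks.length * (s * B * β) := by positivity
          linarith) (fun S' h1 _ h2 => hprob S' ρ hρ
            (hcand.insert hA hc hρ hkK (fun p hp => h1 p (Finset.mem_toList.mpr hp))
              (fun p hp => by
                rcases h2 p hp with h' | h'
                · simp at h'
                · exact ⟨Finset.mem_toList.mp h'.1, h'.2⟩)))
      refine le_trans ?_ h3
      have h4 := mul_le_mul_of_nonneg_right (show ((((S ×ˢ A k).image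
        (fun q => Function.update q.1 k q.2)).toList.length : ℕ) : ℝ) ≤ s * B by
          exact_mod_cast hlen) hβ0
      rw [List.length_cons]
      push_cast
      linarith

/-- Learning by extending the prefixes one position at a time, with local measurements. -/
theorem exists_protocol_isLocal_learns [NeZero d]
    {A : Fin n → Finset (EuclideanSpace ℂ (Fin d))}
    (hA : ∀ k, ∀ φ ∈ A k, ‖φ‖ = 1) {s : ℕ} (hs : ∀ k, (A k).card ≤ s)
    {c : Fin n → EuclideanSpace ℂ (Fin d)} (hc : ∀ k, c k ∈ A k) {η ε δ : ℝ} (hη1 : η ≤ 1)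
    (hε : 0 < ε) (hε1 : ε ≤ 1) (N B : ℕ)
    (hB : ∀ ρ, IsDensity ρ → ∀ K S, IsCandidateSet A c η ε ρ K S → S.card ≤ B)
    (hN : n * (s * B * (2 * Real.exp (-(N * (ε ^ 2 / 16))))) ≤ δ) :
    ∃ T : Protocol n d, T.IsLocal ∧ T.copies ≤ n * (s * B * N) ∧ T.Learns A η ε δ := by
  classical
  obtain ⟨T, hT, hTc, h⟩ := exists_protocol_levels hA hs hc hε hε1 N B hB Finset.univ.toList
    (Finset.nodup_toList _) ∅ (by simp) {c}
  rw [Finset.length_toList, Finset.card_univ, Fintype.card_fin] at hTc h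
  refine ⟨T, hT, hTc, fun ρ hρ => (sub_le_sub_left hN 1).trans (h ρ hρ ⟨?_, ?_⟩)⟩
  · intro p _ hp _
    rw [Finset.mem_singleton]
    exact funext fun k => hp k (by simp)
  · intro p hp
    rw [Finset.mem_singleton] at hp
    subst hp
    refine ⟨hc, fun _ _ => rfl, ?_⟩
    rw [prefixFidelity_empty hρ]
    linarith

end Tree

/-! ### Numerical estimates for the number of copies. -/

/-- Amounts to e⁹ ≤ 10⁴. In 9/4 = 2 + 1/4, the 2 comes from the size bound and the 1/4 absorbs a
factor 1 + L. -/
theorem exp_mul_le_ten_rpow {L : ℝ} (hL : 0 ≤ L) : Real.exp (9 / 4 * L) ≤ (10 : ℝ) ^ L := by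
  have h : (9 / 4 : ℝ) ≤ Real.log 10 := by
    rw [Real.le_log_iff_exp_le (by norm_num)]
    refine le_of_pow_le_pow_left₀ (n := 4) (by norm_num) (by norm_num) ?_
    rw [← Real.exp_nat_mul, show ((4 : ℕ) : ℝ) * (9 / 4) = ((9 : ℕ) : ℝ) * 1 by norm_num,
      Real.exp_nat_mul]
    calc Real.exp 1 ^ 9 ≤ 2.7182818286 ^ 9 :=
          pow_le_pow_left₀ (Real.exp_pos _).le Real.exp_one_lt_d9.le 9
      _ ≤ 10 ^ 4 := by norm_num
  rw [Real.rpow_def_of_pos (by norm_num), Real.exp_le_exp]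
  exact mul_le_mul_of_nonneg_right h hL

/-- This is where 25 comes from: 25/η = (4/η)·(25/4) with log(25/4) ≥ 3/2. The gain 3/2 in the
exponent pays for the factor ns of the tree (1) and for log(ns) (1/2). -/
theorem log_div_add_le {η l : ℝ} (hη0 : 0 < η) (hl0 : 0 < l) (hl1 : l ≤ 1) :
    Real.log (2 / (η / 2)) / l + 3 / 2 ≤ Real.log (25 / η) / l := by
  have h1 : (3 / 2 : ℝ) ≤ Real.log (25 / 4) := by
    rw [Real.le_log_iff_exp_le (by norm_num)]
    refine le_of_pow_le_pow_left₀ (n := 2) (by norm_num) (by norm_num) ?_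
    rw [← Real.exp_nat_mul, show ((2 : ℕ) : ℝ) * (3 / 2) = ((3 : ℕ) : ℝ) * 1 by norm_num,
      Real.exp_nat_mul]
    calc Real.exp 1 ^ 3 ≤ 2.7182818286 ^ 3 :=
          pow_le_pow_left₀ (Real.exp_pos _).le Real.exp_one_lt_d9.le 3
      _ ≤ (25 / 4) ^ 2 := by norm_num
  have h2 : Real.log (25 / η) = Real.log (2 / (η / 2)) + Real.log (25 / 4) := by
    rw [← Real.log_mul (by positivity) (by norm_num)]
    congr 1
    field_simp
    norm_num
  rw [h2, add_div]
  have : 3 / 2 ≤ Real.log (25 / 4) / l := by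
    rw [le_div_iff₀ hl0]
    nlinarith
  linarith

theorem one_add_log_le {x : ℝ} (hx : 1 ≤ x) : 1 + Real.log x ≤ 2 * x ^ (1 / 2 : ℝ) := by
  have h := Real.log_le_sub_one_of_pos (Real.rpow_pos_of_pos (by linarith : 0 < x) (1 / 2))
  rw [Real.log_rpow (by linarith)] at h
  linarith

theorem log_two_mul_div_le {x L δ : ℝ} (hx : 1 ≤ x) (hL : 0 ≤ L) (hδ0 : 0 < δ) :
    Real.log (2 * (x * (Real.exp (2 * L) * x ^ L)) / δ) ≤
      max 1 (Real.log (1 / δ)) * ((2 + 2 * L) * (1 + Real.log x)) := by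
  have hx0 : 0 < x := by linarith
  have hlx : 0 ≤ Real.log x := Real.log_nonneg hx
  have e : Real.log (2 * (x * (Real.exp (2 * L) * x ^ L)) / δ)
      = Real.log 2 + (Real.log x + (2 * L + L * Real.log x)) + Real.log (1 / δ) := by
    rw [div_eq_mul_one_div, Real.log_mul (by positivity) (by positivity),
      Real.log_mul (by norm_num) (by positivity), Real.log_mul (by positivity) (by positivity),
      Real.log_mul (by positivity) (by positivity), Real.log_exp, Real.log_rpow hx0]
  rw [e]
  have h2 : Real.log 2 ≤ 1 := by linarith [Real.log_two_lt_d9]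
  have hm1 := le_max_left 1 (Real.log (1 / δ))
  have hm2 := le_max_right 1 (Real.log (1 / δ))
  set m := max 1 (Real.log (1 / δ))
  have hLx : 0 ≤ L * Real.log x := mul_nonneg hL hlx
  have h3 : Real.log x + (2 * L + L * Real.log x)
      ≤ m * (Real.log x + (2 * L + L * Real.log x)) :=
    le_mul_of_one_le_left (by positivity) hm1
  have h4 : 0 ≤ m * (Real.log x + L * Real.log x) := by positivity
  nlinarith

/-- The logarithmic factors are absorbed by 1 + L ≤ 4exp(L/4) and 1 + log x ≤ 2√x; 272 = 34·8, where
34 = 32 + 2 includes the rounding term. -/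
theorem treeCost_le {x L E ε δ : ℝ} (hx : 1 ≤ x) (hL : 0 ≤ L) (hE : L + 3 / 2 ≤ E) (hε : 0 < ε)
    (hε1 : ε ≤ 1) (hδ0 : 0 < δ) :
    x * (Real.exp (2 * L) * x ^ L)
        * (Real.log (2 * (x * (Real.exp (2 * L) * x ^ L)) / δ) * (16 / ε ^ 2) + 1) ≤
      272 * ((10 * x) ^ E * (1 / ε ^ 2) * max 1 (Real.log (1 / δ))) := by
  have hx0 : 0 < x := by linarith
  have hlx : 0 ≤ Real.log x := Real.log_nonneg hx
  have hm1 := le_max_left 1 (Real.log (1 / δ))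
  have hlog := log_two_mul_div_le hx hL hδ0
  set m := max 1 (Real.log (1 / δ))
  have hm0 : 0 ≤ m := by linarith
  have hε2 : 1 ≤ 1 / ε ^ 2 := by
    rw [one_le_div (by positivity)]
    exact pow_le_one₀ hε.le hε1
  have h1 : 1 ≤ m * ((1 + L) * (1 + Real.log x)) := by
    have : 1 ≤ (1 + L) * (1 + Real.log x) := by nlinarith [mul_nonneg hL hlx]
    nlinarith
  have h2 : Real.log (2 * (x * (Real.exp (2 * L) * x ^ L)) / δ) * (16 / ε ^ 2) + 1
      ≤ 34 * m * ((1 + L) * (1 + Real.log x)) * (1 / ε ^ 2) := by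
    have h3 := mul_le_mul_of_nonneg_right hlog (show 0 ≤ 16 / ε ^ 2 by positivity)
    have h4 : 1 ≤ 2 * (m * ((1 + L) * (1 + Real.log x)) * (1 / ε ^ 2)) := by nlinarith
    have e : m * ((2 + 2 * L) * (1 + Real.log x)) * (16 / ε ^ 2)
        = 32 * (m * ((1 + L) * (1 + Real.log x)) * (1 / ε ^ 2)) := by ring
    rw [e] at h3
    linarith
  have h5 : 1 + L ≤ 4 * Real.exp (1 / 4 * L) := by
    have := Real.add_one_le_exp (1 / 4 * L)
    linarith
  have h6 := one_add_log_le hx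
  have h7 : (1 + L) * (1 + Real.log x) ≤ 8 * (Real.exp (1 / 4 * L) * x ^ (1 / 2 : ℝ)) := by
    calc (1 + L) * (1 + Real.log x) ≤ (4 * Real.exp (1 / 4 * L)) * (2 * x ^ (1 / 2 : ℝ)) :=
          mul_le_mul h5 h6 (by positivity) (by positivity)
      _ = _ := by ring
  have h8 : x * (Real.exp (2 * L) * x ^ L) * (Real.exp (1 / 4 * L) * x ^ (1 / 2 : ℝ))
      ≤ (10 * x) ^ E := by
    have e : x * (Real.exp (2 * L) * x ^ L) * (Real.exp (1 / 4 * L) * x ^ (1 / 2 : ℝ))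
        = Real.exp (9 / 4 * L) * x ^ (L + 3 / 2) := by
      rw [show L + 3 / 2 = 1 + L + 1 / 2 by ring, Real.rpow_add hx0, Real.rpow_add hx0,
        Real.rpow_one, show 9 / 4 * L = 2 * L + 1 / 4 * L by ring, Real.exp_add]
      ring
    rw [e]
    calc Real.exp (9 / 4 * L) * x ^ (L + 3 / 2)
        ≤ (10 : ℝ) ^ (L + 3 / 2) * x ^ (L + 3 / 2) := by
          refine mul_le_mul_of_nonneg_right ((exp_mul_le_ten_rpow hL).trans ?_) (by positivity)
          exact Real.rpow_le_rpow_of_exponent_le (by norm_num) (by linarith)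
      _ = (10 * x) ^ (L + 3 / 2) := (Real.mul_rpow (by norm_num) hx0.le).symm
      _ ≤ (10 * x) ^ E := Real.rpow_le_rpow_of_exponent_le (by linarith) hE
  calc _ ≤ x * (Real.exp (2 * L) * x ^ L)
        * (34 * m * (8 * (Real.exp (1 / 4 * L) * x ^ (1 / 2 : ℝ))) * (1 / ε ^ 2)) := by
        refine mul_le_mul_of_nonneg_left (h2.trans ?_) (by positivity)
        gcongr
    _ = 272 * ((x * (Real.exp (2 * L) * x ^ L) * (Real.exp (1 / 4 * L) * x ^ (1 / 2 : ℝ)))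
        * (1 / ε ^ 2) * m) := by ring
    _ ≤ _ := by gcongr

theorem mul_exp_neg_le {a c δ : ℝ} {N : ℕ} (ha : 0 < a) (hδ : 0 < δ) (hc : 0 < c)
    (hN : Real.log (a / δ) * (1 / c) ≤ N) : a * Real.exp (-(N * c)) ≤ δ := by
  have h : Real.log (a / δ) ≤ N * c := by
    calc Real.log (a / δ) = Real.log (a / δ) * (1 / c) * c := by field_simp
      _ ≤ N * c := mul_le_mul_of_nonneg_right hN hc.le
  rw [Real.log_le_iff_le_exp (by positivity), div_le_iff₀ hδ] at h
  rw [Real.exp_neg, ← div_eq_mul_inv, div_le_iff₀ (Real.exp_pos _)]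
  linarith

/-! ### Assembling the theorem. -/

theorem exists_trivial_protocol {n d : ℕ} {A : Fin n → Finset (EuclideanSpace ℂ (Fin d))}
    {k : Fin n} (hk : A k = ∅) {η ε δ : ℝ} (hδ : 0 ≤ δ) :
    ∃ T : Protocol n d, T.IsLocal ∧ T.Learns A η ε δ ∧ T.copies = 0 := by
  have h : ∀ ρ η, goodStates A ρ η = ∅ := by
    intro ρ η
    rw [Set.eq_empty_iff_forall_notMem]
    rintro v ⟨⟨p, hp, -⟩, -⟩
    simpa [hk] using hp k
  refine ⟨.output ∅, trivial, fun ρ _ => ?_, rfl⟩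
  rw [Protocol.prob_output_of_mem]
  · linarith
  · simp [h]

/-- The number of copies allowed. -/
noncomputable def copyBound (n s : ℕ) (γ η ε δ : ℝ) : ℝ :=
  (10 * n * s : ℝ) ^ (Real.log (25 / η) / Real.log (1 / γ)) * (1 / ε ^ 2)
    * max 1 (Real.log (1 / δ))

theorem copyBound_nonneg (n s : ℕ) (γ η ε δ : ℝ) : 0 ≤ copyBound n s γ η ε δ := by
  have : (0 : ℝ) ≤ max 1 (Real.log (1 / δ)) := le_max_of_le_left zero_le_one
  unfold copyBound
  positivity

theorem neZero_of_unit_mem {d : ℕ} {v : EuclideanSpace ℂ (Fin d)} (hv : ‖v‖ = 1) : NeZero d := by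
  refine ⟨fun h => ?_⟩
  subst h
  rw [Subsingleton.elim v 0, norm_zero] at hv
  exact zero_ne_one hv

theorem log_one_div_mem {γ : ℝ} (hγ0 : 1 / Real.exp 1 ≤ γ) (hγ1 : γ < 1) :
    0 < Real.log (1 / γ) ∧ Real.log (1 / γ) ≤ 1 := by
  have hγpos : 0 < γ := lt_of_lt_of_le (by positivity) hγ0
  refine ⟨Real.log_pos (by rw [lt_div_iff₀ hγpos]; linarith), ?_⟩
  rw [Real.log_le_iff_le_exp (by positivity)]
  rw [div_le_iff₀ (by positivity)] at hγ0 ⊢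
  linarith

/-- Learning with general measurements, with the bound on the number of copies. Since `𝒫` has at
most `s ^ n` members, `O(n s log(1/δ) / ε²)` copies suffice, whatever the overlaps are. -/
theorem exists_learner {n d s : ℕ} {A : Fin n → Finset (EuclideanSpace ℂ (Fin d))} {γ : ℝ}
    (hn : 0 < n) (hA : ∀ k, ∀ φ ∈ A k, ‖φ‖ = 1) (hs : ∀ k, (A k).card ≤ s)
    (hγ0 : 1 / Real.exp 1 ≤ γ) (hγ1 : γ < 1) {η ε δ : ℝ} (hη0 : 0 < η) (hη1 : η < 1)
    (hε : 0 < ε) (hε1 : ε ≤ 1) (hδ0 : 0 < δ) :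
    ∃ T : Protocol n d, T.Learns A η ε δ ∧ (T.copies : ℝ) ≤ 2000 * copyBound n s γ η ε δ := by
  by_cases hne : ∃ k, A k = ∅
  · obtain ⟨k, hk⟩ := hne
    obtain ⟨T, -, hT, hc⟩ := exists_trivial_protocol hk (η := η) (ε := ε) hδ0.le
    exact ⟨T, hT, by rw [hc, Nat.cast_zero]; linarith [copyBound_nonneg n s γ η ε δ]⟩
  push Not at hne
  have hcard : ∀ k, 1 ≤ (A k).card := fun k => Finset.card_pos.mpr (hne k)
  have hs0 : 1 ≤ s := (hcard ⟨0, hn⟩).trans (hs _)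
  obtain ⟨hl0, hl1⟩ := log_one_div_mem hγ0 hγ1
  have hn' : (1 : ℝ) ≤ n := by exact_mod_cast hn
  have hs' : (1 : ℝ) ≤ s := by exact_mod_cast hs0
  have hx : (1 : ℝ) ≤ n * s := by nlinarith
  set P : ℕ := ∏ k, (A k).card with hP
  have hP1 : (1 : ℝ) ≤ P := by
    exact_mod_cast Finset.one_le_prod' fun k _ => hcard k
  have hPs : (P : ℝ) ≤ (s : ℝ) ^ n := by
    have : P ≤ s ^ n := by
      calc P ≤ ∏ _k : Fin n, s := Finset.prod_le_prod' fun k _ => hs k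
        _ = s ^ n := by simp
    exact_mod_cast this
  obtain ⟨T, hTc, hT⟩ := exists_protocol_learns A hA (η := η) hε
    ⌈Real.log (2 * P / δ) * (1 / (ε ^ 2 / 640))⌉₊
    (mul_exp_neg_le (by positivity) hδ0 (by positivity) (Nat.le_ceil _))
  refine ⟨T, hT, ?_⟩
  have hlogP : Real.log P ≤ n * s := by
    calc Real.log P ≤ Real.log ((s : ℝ) ^ n) := Real.log_le_log (by linarith) hPs
      _ = n * Real.log s := Real.log_pow _ _
      _ ≤ n * s := by
        have := Real.log_le_sub_one_of_pos (by linarith : (0 : ℝ) < s)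
        gcongr
        linarith
  have hm1 := le_max_left 1 (Real.log (1 / δ))
  have hm2 := le_max_right 1 (Real.log (1 / δ))
  have hlog : Real.log (2 * P / δ) ≤ max 1 (Real.log (1 / δ)) * (3 * (n * s)) := by
    rw [div_eq_mul_one_div, Real.log_mul (by positivity) (by positivity),
      Real.log_mul (by norm_num) (by positivity)]
    have h2 : Real.log 2 ≤ 1 := by linarith [Real.log_two_lt_d9]
    have h3 : (1 : ℝ) * (n * s) ≤ max 1 (Real.log (1 / δ)) * (n * s) := by gcongr
    have h4 : max 1 (Real.log (1 / δ)) * 1 ≤ max 1 (Real.log (1 / δ)) * (n * s) := by gcongr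
    linarith
  rw [copyBound]
  set m := max 1 (Real.log (1 / δ))
  have hpow : (n * s : ℝ) ≤ (10 * n * s : ℝ) ^ (Real.log (25 / η) / Real.log (1 / γ)) := by
    have hE := log_div_add_le hη0 hl0 hl1
    have h4 : 0 ≤ Real.log (2 / (η / 2)) :=
      Real.log_nonneg (by rw [le_div_iff₀ (by positivity)]; linarith)
    have h5 : 0 ≤ Real.log (2 / (η / 2)) / Real.log (1 / γ) := div_nonneg h4 hl0.le
    calc (n * s : ℝ) ≤ (10 * n * s : ℝ) ^ (1 : ℝ) := by rw [Real.rpow_one]; nlinarith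
      _ ≤ _ := Real.rpow_le_rpow_of_exponent_le (by nlinarith) (by linarith)
  have hε2 : 1 ≤ 1 / ε ^ 2 := by
    rw [one_le_div (by positivity)]
    exact pow_le_one₀ hε.le hε1
  have hlog0 : 0 ≤ m * (3 * (n * s)) := by positivity
  have hceil : ((⌈Real.log (2 * P / δ) * (1 / (ε ^ 2 / 640))⌉₊ : ℕ) : ℝ)
      ≤ m * (3 * (n * s)) * (1 / (ε ^ 2 / 640)) + 1 := by
    refine (Nat.cast_le.mpr (Nat.ceil_le_ceil
      (mul_le_mul_of_nonneg_right hlog (by positivity)))).trans ?_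
    exact (Nat.ceil_lt_add_one (by positivity)).le
  have h1 : 1 ≤ m * (n * s) := by nlinarith
  have h2 : 1 ≤ m * (n * s) * (1 / ε ^ 2) := by nlinarith
  calc (T.copies : ℝ) ≤ _ := Nat.cast_le.mpr hTc
    _ ≤ _ := hceil
    _ = 1920 * (m * (n * s) * (1 / ε ^ 2)) + 1 := by field_simp; ring
    _ ≤ 2000 * ((n * s) * (1 / ε ^ 2) * m) := by linarith
    _ ≤ _ := by gcongr

/-- Learning with local measurements, with the bound on the number of copies. -/
theorem exists_local_learner {n d s : ℕ} {A : Fin n → Finset (EuclideanSpace ℂ (Fin d))} {γ : ℝ}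
    (hn : 0 < n) (hA : ∀ k, ∀ φ ∈ A k, ‖φ‖ = 1) (hs : ∀ k, (A k).card ≤ s)
    (hγ0 : 1 / Real.exp 1 ≤ γ) (hγ1 : γ < 1)
    (hov : ∀ k, ∀ φ ∈ A k, ∀ φ' ∈ A k, φ ≠ φ' → ‖inner ℂ φ φ'‖ ≤ γ)
    {η ε δ : ℝ} (hη0 : 0 < η) (hη1 : η < 1)
    (hε : 0 < ε) (hεη : ε ≤ η / 2) (hδ0 : 0 < δ) :
    ∃ T : Protocol n d, T.IsLocal ∧ T.Learns A η ε δ ∧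
      (T.copies : ℝ) ≤ 2000 * copyBound n s γ η ε δ := by
  by_cases hne : ∃ k, A k = ∅
  · obtain ⟨k, hk⟩ := hne
    obtain ⟨T, hTl, hT, hc⟩ := exists_trivial_protocol hk (η := η) (ε := ε) hδ0.le
    exact ⟨T, hTl, hT, by rw [hc, Nat.cast_zero]; linarith [copyBound_nonneg n s γ η ε δ]⟩
  push Not at hne
  choose c hc using hne
  have : NeZero d := neZero_of_unit_mem (hA _ _ (hc ⟨0, hn⟩))
  have hs0 : 0 < s := (Finset.card_pos.mpr ⟨_, hc ⟨0, hn⟩⟩).trans_le (hs _)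
  obtain ⟨hl0, hl1⟩ := log_one_div_mem hγ0 hγ1
  have hn' : (1 : ℝ) ≤ n := by exact_mod_cast hn
  have hs' : (1 : ℝ) ≤ s := by exact_mod_cast hs0
  have hx : (1 : ℝ) ≤ n * s := by nlinarith
  have hE := log_div_add_le hη0 hl0 hl1
  have hL : 0 ≤ Real.log (2 / (η / 2)) / Real.log (1 / γ) :=
    div_nonneg (Real.log_nonneg (by rw [le_div_iff₀ (by positivity)]; linarith)) hl0.le
  set L := Real.log (2 / (η / 2)) / Real.log (1 / γ) with hLdef
  set x : ℝ := n * s with hxdef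
  have hε1 : ε ≤ 1 := by linarith
  set F : ℝ := Real.exp (2 * L) * x ^ L with hF
  have hF0 : 0 < F := by positivity
  have hBF : ((⌊F⌋₊ : ℕ) : ℝ) ≤ F := Nat.floor_le hF0.le
  -- Candidates have marginal fidelity at least η - ε ≥ η/2, hence the size bound is used at η/2.
  have hB : ∀ ρ, IsDensity ρ → ∀ K S, IsCandidateSet A c η ε ρ K S → S.card ≤ ⌊F⌋₊ := by
    intro ρ hρ K S hS
    refine Nat.le_floor ?_
    exact card_le_of_le_prefixFidelity hA hs hn hs0 hγ0 hγ1 hov (by positivity) (by linarith) hρ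
      (fun p hp => (hS.2 p hp).1) (fun p hp => (hS.2 p hp).2.1)
      (fun p hp => le_trans (by linarith) (hS.2 p hp).2.2)
  set N := ⌈Real.log (2 * (x * F) / δ) * (1 / (ε ^ 2 / 16))⌉₊ with hN
  have hβ : n * (s * (⌊F⌋₊ : ℕ) * (2 * Real.exp (-(N * (ε ^ 2 / 16))))) ≤ δ := by
    calc n * (s * (⌊F⌋₊ : ℕ) * (2 * Real.exp (-(N * (ε ^ 2 / 16)))))
        ≤ n * (s * F * (2 * Real.exp (-(N * (ε ^ 2 / 16))))) := by gcongr
      _ = 2 * (x * F) * Real.exp (-(N * (ε ^ 2 / 16))) := by rw [hxdef]; ring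
      _ ≤ δ := mul_exp_neg_le (by positivity) hδ0 (by positivity) (Nat.le_ceil _)
  obtain ⟨T, hTl, hTc, hT⟩ := exists_protocol_isLocal_learns hA hs hc hη1.le hε hε1 N _ hB hβ
  refine ⟨T, hTl, hT, ?_⟩
  have hcost := treeCost_le hx hL hE hε hε1 hδ0
  have hCB := copyBound_nonneg n s γ η ε δ
  -- The natural-number ceiling is 0 at nonpositive arguments, where it need not be below the
  -- argument plus 1.
  rcases le_or_gt (Real.log (2 * (x * F) / δ) * (1 / (ε ^ 2 / 16))) 0 with hneg | hpos
  · have hN0 : N = 0 := Nat.ceil_eq_zero.mpr hneg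
    rw [hN0] at hTc
    have : T.copies = 0 := by simpa using hTc
    rw [this, Nat.cast_zero]
    linarith
  · have hNle : (N : ℝ) ≤ Real.log (2 * (x * F) / δ) * (16 / ε ^ 2) + 1 := by
      rw [← one_div_div (ε ^ 2) 16]
      exact (Nat.ceil_lt_add_one hpos.le).le
    calc (T.copies : ℝ) ≤ ((n * (s * ⌊F⌋₊ * N) : ℕ) : ℝ) := Nat.cast_le.mpr hTc
      _ = x * (⌊F⌋₊ : ℕ) * N := by push_cast; rw [hxdef]; ring
      _ ≤ x * F * (Real.log (2 * (x * F) / δ) * (16 / ε ^ 2) + 1) := by gcongr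
      _ ≤ 272 * copyBound n s γ η ε δ := by
        rw [copyBound, mul_assoc (10 : ℝ)]
        exact hcost
      _ ≤ 2000 * copyBound n s γ η ε δ := by linarith

/-- The bound on the size of `𝒫_η`. -/
theorem goodStates_finite_and_ncard_le {n d s : ℕ}
    {A : Fin n → Finset (EuclideanSpace ℂ (Fin d))} {γ : ℝ}
    (hn : 0 < n) (hA : ∀ k, ∀ φ ∈ A k, ‖φ‖ = 1) (hs : ∀ k, (A k).card ≤ s)
    (hγ0 : 1 / Real.exp 1 ≤ γ) (hγ1 : γ < 1)
    (hov : ∀ k, ∀ φ ∈ A k, ∀ φ' ∈ A k, φ ≠ φ' → ‖inner ℂ φ φ'‖ ≤ γ)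
    {η : ℝ} (hη0 : 0 < η) (hη1 : η < 1)
    {ρ : Matrix (Fin n → Fin d) (Fin n → Fin d) ℂ} (hρ : IsDensity ρ) :
    (goodStates A ρ η).Finite ∧ ((goodStates A ρ η).ncard : ℝ) ≤
      (10 * n * s : ℝ) ^ (Real.log (2 / η) / Real.log (1 / γ)) := by
  classical
  by_cases hne : ∃ k, A k = ∅
  · obtain ⟨k, hk⟩ := hne
    have h : goodStates A ρ η = ∅ := by
      rw [Set.eq_empty_iff_forall_notMem]
      rintro v ⟨⟨p, hp, -⟩, -⟩
      simpa [hk] using hp k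
    rw [h]
    refine ⟨Set.finite_empty, ?_⟩
    rw [Set.ncard_empty, Nat.cast_zero]
    positivity
  push Not at hne
  choose c hc using hne
  have : NeZero d := neZero_of_unit_mem (hA _ _ (hc ⟨0, hn⟩))
  have hs0 : 0 < s := (Finset.card_pos.mpr ⟨_, hc ⟨0, hn⟩⟩).trans_le (hs _)
  obtain ⟨hl0, hl1⟩ := log_one_div_mem hγ0 hγ1
  set G := (Fintype.piFinset A).filter fun p => η ≤ fidelity ρ (productState p) with hG
  have hsub : goodStates A ρ η ⊆ (G.image productState : Finset _) := by
    rintro v ⟨⟨p, hp, rfl⟩, hv⟩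
    exact Finset.mem_coe.mpr (Finset.mem_image_of_mem _
      (Finset.mem_filter.mpr ⟨Fintype.mem_piFinset.mpr hp, hv⟩))
  refine ⟨(Finset.finite_toSet _).subset hsub, ?_⟩
  have h1 : (goodStates A ρ η).ncard ≤ G.card := by
    refine (Set.ncard_le_ncard hsub (Finset.finite_toSet _)).trans ?_
    rw [Set.ncard_coe_finset]
    exact Finset.card_image_le
  have h2 := card_le_of_le_prefixFidelity hA hs hn hs0 hγ0 hγ1 hov hη0 hη1 hρ
    (K := Finset.univ) (c := c) (G := G)
    (fun p hp => Fintype.mem_piFinset.mp (Finset.mem_filter.mp hp).1)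
    (fun p _ k hk => absurd (Finset.mem_univ k) hk)
    (fun p hp => by rw [prefixFidelity_univ]; exact (Finset.mem_filter.mp hp).2)
  have hL : 0 ≤ Real.log (2 / η) / Real.log (1 / γ) :=
    div_nonneg (Real.log_nonneg (by rw [le_div_iff₀ (by positivity)]; linarith)) hl0.le
  set L := Real.log (2 / η) / Real.log (1 / γ)
  calc ((goodStates A ρ η).ncard : ℝ) ≤ G.card := Nat.cast_le.mpr h1
    _ ≤ _ := h2
    _ ≤ (10 : ℝ) ^ L * (n * s : ℝ) ^ L := by
      refine mul_le_mul_of_nonneg_right (le_trans ?_ (exp_mul_le_ten_rpow hL)) (by positivity)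
      exact Real.exp_le_exp.mpr (by linarith)
    _ = (10 * n * s : ℝ) ^ L := by
      rw [mul_assoc, Real.mul_rpow (x := 10) (y := (n * s : ℝ)) (by norm_num) (by positivity)]

theorem theorem4 :
    ∃ C : ℝ, 0 < C ∧
      ∀ (n d s : ℕ) (A : Fin n → Finset (EuclideanSpace ℂ (Fin d))) (γ : ℝ),
        0 < n →
        (∀ k, ∀ φ ∈ A k, ‖φ‖ = 1) →
        (∀ k, (A k).card ≤ s) →
        1 / Real.exp 1 ≤ γ → γ < 1 →
        -- the learning guarantee, for pairwise fidelity at most `γ`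
        ((∀ k, ∀ φ ∈ A k, ∀ φ' ∈ A k, φ ≠ φ' → ‖inner ℂ φ φ'‖ ^ 2 ≤ γ) →
          ∀ η ε δ : ℝ, 0 < η → η < 1 → 0 < ε → ε ≤ η / 2 → 0 < δ → δ < 1 →
            ∃ T : Protocol n d, T.Learns A η ε δ ∧
              (T.copies : ℝ) ≤
                C * ((10 * n * s : ℝ) ^ (Real.log (25 / η) / Real.log (1 / γ)) * (1 / ε ^ 2)
                  * max 1 (Real.log (1 / δ)))) ∧
        -- the size bound and local measurements, for pairwise overlap at most `γ`
        ((∀ k, ∀ φ ∈ A k, ∀ φ' ∈ A k, φ ≠ φ' → ‖inner ℂ φ φ'‖ ≤ γ) →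
          (∀ η : ℝ, 0 < η → η < 1 → ∀ ρ, IsDensity ρ →
            (goodStates A ρ η).Finite ∧
              ((goodStates A ρ η).ncard : ℝ) ≤
                (10 * n * s : ℝ) ^ (Real.log (2 / η) / Real.log (1 / γ))) ∧
          ∀ η ε δ : ℝ, 0 < η → η < 1 → 0 < ε → ε ≤ η / 2 → 0 < δ → δ < 1 →
            ∃ T : Protocol n d, T.IsLocal ∧ T.Learns A η ε δ ∧
              (T.copies : ℝ) ≤
                C * ((10 * n * s : ℝ) ^ (Real.log (25 / η) / Real.log (1 / γ)) * (1 / ε ^ 2)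
                  * max 1 (Real.log (1 / δ)))) := by
  refine ⟨2000, by norm_num, fun n d s A γ hn hA hs hγ0 hγ1 => ⟨?_, fun hov => ⟨?_, ?_⟩⟩⟩
  · intro _ η ε δ hη0 hη1 hε hεη hδ0 _
    exact exists_learner hn hA hs hγ0 hγ1 hη0 hη1 hε (by linarith) hδ0
  · intro η hη0 hη1 ρ hρ
    exact goodStates_finite_and_ncard_le hn hA hs hγ0 hγ1 hov hη0 hη1 hρ
  · intro η ε δ hη0 hη1 hε hεη hδ0 _
    exact exists_local_learner hn hA hs hγ0 hγ1 hov hη0 hη1 hε hεη hδ0
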